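/- Let $T>0$, $\varepsilon>0$, $\theta\in(0,1)$ and $f(r)=\log\frac{1+r}{1-r}$ for $|r|<1$. Let $\Gamma_0\subset\mathbb{R}^3$ be a closed, connected, orientable $C^2$ surface and $(\Gamma(t))_{t\in[0,T]}$, $\Gamma(t)=\Phi(\Gamma_0,t)$, a $C^2$ evolving surface, where $\Phi:\Gamma_0\times[0,T]\to\mathbb{R}^3$ is continuous, $\Phi(\cdot,t):\Gamma_0\to\Gamma(t)$ is a $C^2$ diffeomorphism, $\Phi(\cdot,0)=\mathrm{id}$, and $\frac{d}{dt}\Phi(x,t)=V(\Phi(x,t),t)$ for a velocity field $V\in C^1([0,T];C^2(\mathbb{R}^3;\mathbb{R}^3))$. **Triangulations.** Let $\Gamma_h(0)$ be a triangulated surface with nodes $x_i(0)\in\Gamma_0$; the nodes move by $\dot x_i=V(x_i,t)$, and $\Gamma_h(t)$ is the union of the resulting triangles $K(t)\in\mathcal{T}_h(t)$. Put $h=\sup_{t\in[0,T]}\max_{K}\operatorname{diam}K(t)$. For every $t\in[0,T]$ the triangles are non-degenerate, two distinct ones are disjoint or meet in a common node or a common edge, and: (i) the diameter of the largest two-dimensional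 ball in each $K(t)$ is at least $\rho h$, with a fixed $\rho>0$; (ii) $\Gamma_h(t)$ lies in a tubular neighbourhood of $\Gamma(t)$ and is exact, i.e. the normal projection maps $\Gamma_h(t)$ bijectively onto $\Gamma(t)$; (iii) all angles of the triangles are at most $\pi/2$; (iv) $\nabla_{\Gamma_h}\cdot V_h\ge 0$, where $V_h=\sum_i V(x_i,t)\phi_i$ and $\phi_i$ are the nodal basis functions of the space $S_h(t)$ of continuous, elementwise affine functions on $\Gamma_h(t)$. Let $I_h$ be nodal interpolation, $\partial_h^\bullet$ the material derivative along the motion of $\Gamma_h$ with velocity $V_h$, and $$\bar m_h(\eta,\zeta)=\int_{\Gamma_h(t)}I_h(\eta\zeta),\qquad a_h(\eta,\zeta)=\int_{\Gamma_h(t)}\nabla_{\Gamma_h}\eta\cdot\nabla_{\Gamma_h}\zeta,\qquad g_h(\eta,\zeta)=\int_{\Gamma_h(t)}\eta\,\zeta\,\nabla_{\Gamma_h}\cdot V_h .$$ For $z\in S_h(t)$ with $\int_{\Gamma_h(t)}z=0$ let $\bar{\mathcal G}z\in S_h(t)$ be determined by $\int_{\Gamma_h(t)}\bar{\mathcal G}z=0$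 and $a_h(\bar{\mathcal G}z,\phi)=\bar m_h(z,\phi)$ for all $\phi\in S_h(t)$, and let $\|z\|_{-h}^2=a_h(\bar{\mathcal G}z,\bar{\mathcal G}z)$. **Solutions.** Initial data $\eta\in S_h(0)$ is admissible if $|\eta|\le1$ on $\Gamma_h(0)$ and its mean value over $\Gamma_h(0)$ has modulus less than $1$ (its discrete Ginzburg–Landau energy is then finite). A solution pair with initial data $U_{h,0}$ is a pair $(U_h,W_h)$ of continuous functions on $\bigcup_{t\in[0,T]}\Gamma_h(t)\times\{t\}$ with time slices in $S_h(t)$, such that $\partial_h^\bullet U_h$ exists and is continuous, $U_h(0)=U_{h,0}$, and, for almost every $t\in[0,T]$, $|U_h|<1$ on $\Gamma_h(t)$ and, for all $\phi\in S_h(t)$, $$\bar m_h(\partial_h^\bullet U_h,\phi)+g_h(I_h(U_h\phi),1)+a_h(W_h,\phi)=0,$$ $$\bar m_h(W_h,\phi)=\varepsilon a_h(U_h,\phi)+\frac{\theta}{2\varepsilon}\bar m_h(I_hf(U_h),\phi)-\frac1\varepsilon\bar m_h(U_h,\phi).$$ **Claim.** There is a constant $C$, depending only on $T$, the evolving surface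 with its velocity field, $\varepsilon$, $\theta$ and $\rho$ (in particular independent of the triangulation and of $h$), such that for all such triangulations, all admissible initial data $U^1_{h,0},U^2_{h,0}$ with equal mean values over $\Gamma_h(0)$, and all corresponding solution pairs $(U_h^1,W_h^1)$, $(U_h^2,W_h^2)$, the function $\bar{\mathcal G}(U_h^1(t)-U_h^2(t))$ is well defined for every $t\in[0,T]$, $s\mapsto\|\nabla_{\Gamma_h}(U_h^1-U_h^2)(s)\|_{L^2(\Gamma_h(s))}^2$ is integrable on $[0,t]$, and $$\|U_h^1(t)-U_h^2(t)\|_{-h}^2+\varepsilon\int_0^t\|\nabla_{\Gamma_h}(U_h^1-U_h^2)\|_{L^2(\Gamma_h(s))}^2\,ds\le e^{Ct}\,\|U_{h,0}^1-U_{h,0}^2\|_{-h}^2 .$$ In particular solutions are unique: if $U^1_{h,0}=U^2_{h,0}$ on $\Gamma_h(0)$, then $U_h^1=U_h^2$ and $W_h^1=W_h^2$ on $\Gamma_h(t)$ for all $t\in[0,T]$. -/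

import Mathlib

open Set MeasureTheory

noncomputable section

namespace ESFEM

/-- The ambient space `ℝ³`. -/
abbrev E3 := EuclideanSpace ℝ (Fin 3)

/-! ### Closed surfaces and evolving surfaces -/

/-- `φ` is a `C²` defining function of `Γ` on the open set `U`. -/
structure IsLocalDefiningFn (Γ U : Set E3) (φ : E3 → ℝ) : Prop where
  isOpen : IsOpen U
  contDiffOn : ContDiffOn ℝ 2 φ U
  mem_iff : ∀ y ∈ U, y ∈ Γ ↔ φ y = 0
  gradient_ne : ∀ y ∈ U, gradient φ y ≠ 0

/-- A closed (compact, without boundary), connected, orientable embedded `C²` surface in `ℝ³`.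
Orientability is the existence of a continuous unit normal field. -/
structure IsClosedC2Surface (Γ : Set E3) : Prop where
  isCompact : IsCompact Γ
  isConnected : IsConnected Γ
  local_defining : ∀ x ∈ Γ, ∃ (U : Set E3) (φ : E3 → ℝ), x ∈ U ∧ IsLocalDefiningFn Γ U φ
  orientable : ∃ ν : E3 → E3, ContinuousOn ν Γ ∧ ∀ x ∈ Γ, ‖ν x‖ = 1 ∧
    ∀ (U : Set E3) (φ : E3 → ℝ), x ∈ U → IsLocalDefiningFn Γ U φ →
      ∃ c : ℝ, gradient φ x = c • ν x

/-- `f` is a `C²` diffeomorphism of the subset `Γ` of `ℝ³` onto its image: `f` and the inverse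
map `f '' Γ → Γ` both extend to `C²` maps on neighbourhoods of `Γ` and of `f '' Γ`. -/
def IsC2DiffeoOn (f : E3 → E3) (Γ : Set E3) : Prop :=
  ∃ (U U' : Set E3) (F G : E3 → E3), IsOpen U ∧ Γ ⊆ U ∧ IsOpen U' ∧ f '' Γ ⊆ U' ∧
    ContDiffOn ℝ 2 F U ∧ ContDiffOn ℝ 2 G U' ∧ EqOn f F Γ ∧ ∀ x ∈ Γ, G (f x) = x

/-- `V ∈ C¹([0,T]; C²(ℝ³; ℝ³))`: the spatial derivatives of order at most two of `V` exist, are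
continuous on `[0,T] × ℝ³`, and are differentiable in time, the time derivatives being the
spatial derivatives of a field `V'` with the same continuity. -/
def IsC1C2 (T : ℝ) (V : ℝ → E3 → E3) : Prop :=
  ∃ V' : ℝ → E3 → E3,
    (∀ t ∈ Icc 0 T, ContDiff ℝ 2 (V t) ∧ ContDiff ℝ 2 (V' t)) ∧
    ∀ k : ℕ, k ≤ 2 →
      ContinuousOn (fun q : ℝ × E3 => iteratedFDeriv ℝ k (V q.1) q.2) (Icc 0 T ×ˢ univ) ∧
      ContinuousOn (fun q : ℝ × E3 => iteratedFDeriv ℝ k (V' q.1) q.2) (Icc 0 T ×ˢ univ) ∧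
      ∀ x : E3, ∀ t ∈ Icc 0 T,
        HasDerivWithinAt (fun s => iteratedFDeriv ℝ k (V s) x)
          (iteratedFDeriv ℝ k (V' t) x) (Icc 0 T) t

/-- A `C²` evolving surface `(Γ(t))_{t ∈ [0,T]}`: a closed surface `Γ₀`, the flow map
`flow t = Φ(·,t)` on `Γ₀`, and the velocity field `V` on `ℝ³` that generates it. -/
structure EvolvingSurface (T : ℝ) where
  Γ₀ : Set E3
  isClosedC2Surface : IsClosedC2Surface Γ₀
  flow : ℝ → E3 → E3
  velocity : ℝ → E3 → E3
  velocity_regular : IsC1C2 T velocity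
  flow_continuousOn : ContinuousOn (fun q : ℝ × E3 => flow q.1 q.2) (Icc 0 T ×ˢ Γ₀)
  flow_diffeo : ∀ t ∈ Icc 0 T, IsC2DiffeoOn (flow t) Γ₀
  flow_zero : ∀ x ∈ Γ₀, flow 0 x = x
  flow_ode : ∀ x ∈ Γ₀, ∀ t ∈ Icc 0 T,
    HasDerivWithinAt (fun s => flow s x) (velocity t (flow t x)) (Icc 0 T) t

/-- The surface `Γ(t) = Φ(Γ₀, t)`. -/
def EvolvingSurface.surf {T : ℝ} (S : EvolvingSurface T) (t : ℝ) : Set E3 := S.flow t '' S.Γ₀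

/-- `{x | dist(x, Γ) < r}` is a tubular neighbourhood of `Γ`: each of its points has exactly one
nearest point on `Γ`. -/
def IsTubularRadius (Γ : Set E3) (r : ℝ) : Prop :=
  0 < r ∧ ∀ x, Metric.infDist x Γ < r → ∃! p, p ∈ Γ ∧ dist x p = Metric.infDist x Γ

open Classical in
/-- The normal (nearest point) projection onto `Γ`; used on a tubular neighbourhood only. -/
def normalProj (Γ : Set E3) (x : E3) : E3 :=
  if h : ∃ p, p ∈ Γ ∧ dist x p = Metric.infDist x Γ then h.choose else x

/-! ### Calculus on a flat triangle -/

/-- `√(g₁₁ g₂₂ - g₁₂²)` for the edge vectors `b - a`, `c - a`: twice the area of the triangle. -/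
def triJac (a b c : E3) : ℝ :=
  √(‖b - a‖ ^ 2 * ‖c - a‖ ^ 2 - (inner ℝ (b - a) (c - a)) ^ 2)

/-- The surface integral of `f` over the triangle with vertices `a, b, c`, computed in the
parametrisation `(s, r) ↦ a + s (b - a) + r (c - a)`, `s, r ≥ 0`, `s + r ≤ 1`. -/
def triIntegral (a b c : E3) (f : E3 → ℝ) : ℝ :=
  triJac a b c * ∫ s in (0 : ℝ)..1, ∫ r in (0 : ℝ)..(1 - s), f (a + s • (b - a) + r • (c - a))

/-- The tangential gradient, on the triangle with vertices `a, b, c`, of the function that is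
affine there and has the vertex values `η a, η b, η c`, namely
`∑ g^{ij} (∂_j η) e_i` for the edge vectors `e₁ = b - a`, `e₂ = c - a`. It is the vector of the
plane spanned by `e₁, e₂` with `⟪∇η, b - a⟫ = η b - η a`, `⟪∇η, c - a⟫ = η c - η a`. -/
def triGrad (a b c : E3) (η : E3 → ℝ) : E3 :=
  ((triJac a b c) ^ 2)⁻¹ •
    ((‖c - a‖ ^ 2 * (η b - η a) - inner ℝ (b - a) (c - a) * (η c - η a)) • (b - a) +
     (‖b - a‖ ^ 2 * (η c - η a) - inner ℝ (b - a) (c - a) * (η b - η a)) • (c - a))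

/-- `ρ_K`: the supremum of the diameters of the two-dimensional balls (in the plane of `K`)
that are contained in the triangle `K`. -/
def inballDiam (K : Set E3) : ℝ :=
  sSup {d | ∃ x ∈ K, ∃ r : ℝ, 0 ≤ r ∧ d = 2 * r ∧
    Metric.closedBall x r ∩ (affineSpan ℝ K : Set E3) ⊆ K}

/-! ### Evolving triangulated surfaces -/

/-- The combinatorial data of a triangulation together with its initial nodes on `Γ₀`. -/
structure EvolvingMesh {T : ℝ} (S : EvolvingSurface T) where
  numNodes : ℕ
  numTris : ℕ
  node₀ : Fin numNodes → E3
  node₀_mem : ∀ i, node₀ i ∈ S.Γ₀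
  node₀_injective : Function.Injective node₀
  /-- The three vertices of each triangle. -/
  vert : Fin numTris → Fin 3 → Fin numNodes
  vert_injective : ∀ K, Function.Injective (vert K)
  range_vert_injective : Function.Injective fun K => range (vert K)
  node_covered : ∀ i, ∃ K, i ∈ range (vert K)

namespace EvolvingMesh

variable {T : ℝ} {S : EvolvingSurface T} (M : EvolvingMesh S)

/-- The node `x_i(t)`; it solves `x_i' = V(x_i, t)`, by `EvolvingSurface.flow_ode`. -/
def node (i : Fin M.numNodes) (t : ℝ) : E3 := S.flow t (M.node₀ i)

/-- The `j`-th vertex of the triangle `K(t)`. -/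
def vertex (K : Fin M.numTris) (t : ℝ) (j : Fin 3) : E3 := M.node (M.vert K j) t

/-- The closed triangle `K(t)`. -/
def elem (K : Fin M.numTris) (t : ℝ) : Set E3 := convexHull ℝ (range (M.vertex K t))

/-- The triangulated surface `Γ_h(t)`. -/
def surf (t : ℝ) : Set E3 := ⋃ K, M.elem K t

/-- The discrete space-time surface, as a set of pairs `(t, x)`. -/
def spacetime : Set (ℝ × E3) := {q | q.1 ∈ Icc 0 T ∧ q.2 ∈ M.surf q.1}

/-- The mesh size `h = sup_t max_K diam K(t)`. -/
def meshSize : ℝ := sSup {d | ∃ t ∈ Icc 0 T, ∃ K, d = Metric.diam (M.elem K t)}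

/-- `w` is a system of barycentric coordinates of the point `x` of `Γ_h(t)`: `x` is a convex
combination, with the weights `w`, of the nodes of one triangle. -/
def IsBary (t : ℝ) (x : E3) (w : Fin M.numNodes → ℝ) : Prop :=
  ∃ K, (∀ i, 0 ≤ w i) ∧ ∑ i, w i = 1 ∧ (∀ i, i ∉ range (M.vert K) → w i = 0) ∧
    ∑ i, w i • M.node i t = x

open Classical in
/-- The nodal basis function `φ_i(t)` of `Γ_h(t)`: its value at `x` is the barycentric coordinate
of `x` belonging to the node `i` (on a conforming triangulation the coordinates are unique). -/
def hat (i : Fin M.numNodes) (t : ℝ) (x : E3) : ℝ :=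
  if h : ∃ w, M.IsBary t x w then h.choose i else 0

/-- Lagrange interpolation `I_h z = ∑ z(x_i) φ_i`. -/
def interp (t : ℝ) (z : E3 → ℝ) (x : E3) : ℝ := ∑ i, z (M.node i t) * M.hat i t x

/-- The velocity `V_h = ∑ V(x_i, t) φ_i` of `Γ_h(t)`. -/
def discreteVelocity (t : ℝ) (x : E3) : E3 :=
  ∑ i, M.hat i t x • S.velocity t (M.node i t)

/-- The discrete tangential gradient on the element `K(t)` (for functions affine on `K(t)`). -/
def elemGrad (K : Fin M.numTris) (t : ℝ) (η : E3 → ℝ) : E3 :=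
  triGrad (M.vertex K t 0) (M.vertex K t 1) (M.vertex K t 2) η

/-- The (constant) value of `∇_{Γ_h} · V_h = ∑ₖ D_k (V_h)_k` on the element `K(t)`. -/
def elemDiv (K : Fin M.numTris) (t : ℝ) : ℝ :=
  ∑ k : Fin 3, M.elemGrad K t (fun x => M.discreteVelocity t x k) k

/-- The integral over `Γ_h(t)` of an elementwise defined function. -/
def integral (t : ℝ) (f : Fin M.numTris → E3 → ℝ) : ℝ :=
  ∑ K, triIntegral (M.vertex K t 0) (M.vertex K t 1) (M.vertex K t 2) (f K)

/-- The standing assumptions on the evolving triangulation, with quasi-uniformity constant `ρ`. -/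
structure IsAdmissible (ρ : ℝ) : Prop where
  /-- The triangles do not degenerate. -/
  nondegenerate : ∀ t ∈ Icc 0 T, ∀ K, AffineIndependent ℝ (M.vertex K t)
  /-- Two triangles meet exactly in the hull of their common vertices, so distinct triangles are
  disjoint or meet in a common node or a common edge. -/
  conforming : ∀ t ∈ Icc 0 T, ∀ K L, M.elem K t ∩ M.elem L t =
    convexHull ℝ ((fun i => M.node i t) '' (range (M.vert K) ∩ range (M.vert L)))
  /-- Uniform quasi-uniformity. -/
  quasiUniform : ∀ t ∈ Icc 0 T, ∀ K, ρ * M.meshSize ≤ inballDiam (M.elem K t)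
  /-- `Γ_h(t)` lies in a tubular neighbourhood of `Γ(t)`, and the triangulation is exact: the
  lifted triangles form a conforming subdivision of `Γ(t)`, that is, the normal projection maps
  `Γ_h(t)` bijectively onto `Γ(t)`. -/
  exact_lift : ∀ t ∈ Icc 0 T, ∃ r, IsTubularRadius (S.surf t) r ∧
    (∀ x ∈ M.surf t, Metric.infDist x (S.surf t) < r) ∧
    BijOn (normalProj (S.surf t)) (M.surf t) (S.surf t)
  /-- No angle of a triangle exceeds `π / 2`. -/
  acute : ∀ t ∈ Icc 0 T, ∀ K, ∀ i j k : Fin 3, i ≠ j → j ≠ k → i ≠ k →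
    EuclideanGeometry.angle (M.vertex K t i) (M.vertex K t j) (M.vertex K t k) ≤ Real.pi / 2
  /-- `∇_{Γ_h} · V_h ≥ 0`. -/
  div_nonneg : ∀ t ∈ Icc 0 T, ∀ K, 0 ≤ M.elemDiv K t

/-! ### Finite element functions and bilinear forms

Functions on `Γ_h(t)` are represented by functions on `ℝ³`; only their values on `Γ_h(t)` enter
any of the definitions. -/

/-- The space `S_h(t)` of continuous, elementwise affine functions on `Γ_h(t)`. -/
def shape (t : ℝ) : Set (E3 → ℝ) :=
  {φ | ContinuousOn φ (M.surf t) ∧ ∀ K, ∃ A : E3 →ᵃ[ℝ] ℝ, EqOn φ A (M.elem K t)}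

/-- `a_h(t; η, ζ) = ∫ ∇_{Γ_h} η · ∇_{Γ_h} ζ`. -/
def aForm (t : ℝ) (η ζ : E3 → ℝ) : ℝ :=
  M.integral t fun K _ => inner ℝ (M.elemGrad K t η) (M.elemGrad K t ζ)

/-- `g_h(t; η, ζ) = ∫ η ζ ∇_{Γ_h} · V_h`. -/
def gForm (t : ℝ) (η ζ : E3 → ℝ) : ℝ :=
  M.integral t fun K x => η x * ζ x * M.elemDiv K t

/-- The lumped mass form `∫ I_h(η ζ)`. -/
def lumped (t : ℝ) (η ζ : E3 → ℝ) : ℝ :=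
  M.integral t fun _ => M.interp t fun x => η x * ζ x

/-- `‖∇_{Γ_h} η‖²` in `L²(Γ_h(t))`. -/
def gradNormSq (t : ℝ) (η : E3 → ℝ) : ℝ :=
  M.integral t fun K _ => ‖M.elemGrad K t η‖ ^ 2

/-- The mean value of `η` over `Γ_h(t)`. -/
def mean (t : ℝ) (η : E3 → ℝ) : ℝ :=
  (M.integral t fun _ => η) / (M.integral t fun _ _ => 1)

/-- `g` is the mass-lumped discrete inverse Laplacian of `z` on `Γ_h(t)`. -/
def IsLumpedInvLap (t : ℝ) (z g : E3 → ℝ) : Prop :=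
  g ∈ M.shape t ∧ (M.integral t fun _ => g) = 0 ∧
    ∀ φ ∈ M.shape t, M.aForm t g φ = M.lumped t z φ

open Classical in
/-- The mass-lumped discrete inverse Laplacian of `z` (`0` if it does not exist). -/
def lumpedInvLap (t : ℝ) (z : E3 → ℝ) : E3 → ℝ :=
  if h : ∃ g, M.IsLumpedInvLap t z g then h.choose else 0

/-- The norm `‖z‖_{-h}` on `Γ_h(t)`, the square root of `a_h(g, g)` for the mass-lumped discrete
inverse Laplacian `g` of `z`. -/
def invNorm (t : ℝ) (z : E3 → ℝ) : ℝ :=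
  √(M.aForm t (M.lumpedInvLap t z) (M.lumpedInvLap t z))

/-! ### The semi-discrete Cahn-Hilliard system -/

/-- The set of admissible discrete initial data. (The discrete energy of a function in `S_h(0)`
with values in `[-1,1]` is finite, since the potential is continuous on `[-1,1]`.) -/
def admissibleData : Set (E3 → ℝ) :=
  {η | η ∈ M.shape 0 ∧ (∀ x ∈ M.surf 0, |η x| ≤ 1) ∧ |M.mean 0 η| < 1}

/-- Continuous functions on the space-time surface with time slices in `S_h(t)`. -/
def IsDiscreteFn (z : ℝ → E3 → ℝ) : Prop :=
  ContinuousOn (fun q : ℝ × E3 => z q.1 q.2) M.spacetime ∧ ∀ t ∈ Icc 0 T, z t ∈ M.shape t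

/-- `z'` is the strong discrete material derivative of `z`: the derivative of `z` along the paths
`s ↦ ∑ w_i x_i(s)` of the material points of `Γ_h`, which move with the velocity `V_h`. -/
def IsMaterialDeriv (z z' : ℝ → E3 → ℝ) : Prop :=
  ∀ (K : Fin M.numTris) (w : Fin M.numNodes → ℝ), (∀ i, 0 ≤ w i) → ∑ i, w i = 1 →
    (∀ i, i ∉ range (M.vert K) → w i = 0) → ∀ t ∈ Icc 0 T,
      HasDerivWithinAt (fun s => z s (∑ i, w i • M.node i s))
        (z' t (∑ i, w i • M.node i t)) (Icc 0 T) t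

end EvolvingMesh

/-- `f(r) = log((1 + r) / (1 - r))`, the derivative of the logarithmic potential `F_log`; used for
`|r| < 1` only. -/
def logPotDeriv (r : ℝ) : ℝ := Real.log ((1 + r) / (1 - r))

/-- `(U, W)` solves the semi-discrete Cahn-Hilliard system with initial value `U₀`. -/
structure IsSemiDiscreteSolution {T : ℝ} {S : EvolvingSurface T} (M : EvolvingMesh S)
    (ε θ : ℝ) (U₀ : E3 → ℝ) (U W : ℝ → E3 → ℝ) : Prop where
  U_discrete : M.IsDiscreteFn U
  W_discrete : M.IsDiscreteFn W
  initial : EqOn (U 0) U₀ (M.surf 0)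
  /-- The logarithmic potential is defined along the solution. -/
  abs_lt_one : ∀ᵐ t ∂(volume.restrict (Icc 0 T)), ∀ x ∈ M.surf t, |U t x| < 1
  equations : ∃ U' : ℝ → E3 → ℝ,
    ContinuousOn (fun q : ℝ × E3 => U' q.1 q.2) M.spacetime ∧ M.IsMaterialDeriv U U' ∧
    ∀ᵐ t ∂(volume.restrict (Icc 0 T)), ∀ φ ∈ M.shape t,
      M.lumped t (U' t) φ + M.gForm t (M.interp t fun x => U t x * φ x) 1
        + M.aForm t (W t) φ = 0 ∧
      M.lumped t (W t) φ = ε * M.aForm t (U t) φ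
        + θ / (2 * ε) * M.lumped t (M.interp t fun x => logPotDeriv (U t x)) φ
        - 1 / ε * M.lumped t (U t) φ

end ESFEM

end

/-!
In terms of nodal values the system is an ordinary differential equation. Mass lumping makes
`m̄_h` diagonal, with masses `m_i(t) > 0`; the areas of the triangles change at the rate
`∇_{Γ_h} · V_h`, so the coefficients of `g_h` are the derivatives `m_i'`
(`hasDerivWithinAt_jac`, `hasDerivWithinAt_mass`). For the differences `u`, `w` of two solutions
and the stiffness matrix `A(t)` this gives `(m_i u_i)' + (A w)_i = 0` at every time
(`hasDerivWithinAt_load_sub`), since both sides are continuous. In particular `z = (m_i u_i)` keeps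
sum zero, and `A G = z` has a mean free solution `G`, the nodal vector of the inverse Laplacian,
because the kernel of `A` consists of the constants (`const_of_stiffForm_self_eq_zero`). That
uses the connectedness of `Γ_h(t)`, which is inherited from `Γ(t)` through the bijective normal
projection (`isPreconnected_of_bijOn_normalProj`).

The squared norm `E = G · z = G · A G` satisfies `E' = 2 G · z' - G · A' G`, with no derivative of
`G` (`hasDerivWithinAt_energy`), and `G · z' = -w · z`. Testing the second equation with `u` and
using that `f` is increasing, `w · z ≥ ε u · A u - ε⁻¹ u · z` (`mul_stiffForm_sub_le`), where
`u · z = u · A G` is split by Young's inequality. The remaining term is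
`|G · A' G| ≤ C G · A G` (`abs_stiffFormDeriv_le`): on a triangle with edges `e₁, e₂`, Jacobian `J`
and nodal differences `p, q` the Dirichlet form is `|p e₂ - q e₁|² / (2 J)`, the velocity is
Lipschitz along edges, and the inscribed balls give `J ≥ ρ |e₁| |e₂|`
(`mul_norm_edge_le_jac`). Hence this constant depends on the Lipschitz constant of `V` and on `ρ`
only, and Grönwall's inequality (`gronwall_with_dissipation`) concludes. For equal initial data `E`
vanishes, so `u = 0`, and then the second equation gives `w = 0`.
-/

namespace ESFEM

/-! ### Geometry of a flat triangle -/

lemma gram_nonneg (u v : E3) : 0 ≤ ‖u‖ ^ 2 * ‖v‖ ^ 2 - (inner ℝ u v) ^ 2 := by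
  have h := abs_real_inner_le_norm u v
  have h2 := sq_le_sq' (by linarith [neg_abs_le (inner ℝ u v), abs_nonneg (inner ℝ u v)])
    ((le_abs_self _).trans h)
  nlinarith [h2]

lemma triJac_nonneg (a b c : E3) : 0 ≤ triJac a b c := Real.sqrt_nonneg _

lemma triJac_sq (a b c : E3) : triJac a b c ^ 2 =
    ‖b - a‖ ^ 2 * ‖c - a‖ ^ 2 - (inner ℝ (b - a) (c - a)) ^ 2 :=
  Real.sq_sqrt (gram_nonneg _ _)

/-- The tangential gradient rotated by a right angle and scaled by the Jacobian, for vertex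
differences `p, q` and edge vectors `u, v`. -/
abbrev rotGrad (u v : E3) (p q : ℝ) : E3 := p • v - q • u

lemma inner_rotGrad_rotGrad (u v : E3) (p q p' q' : ℝ) :
    inner ℝ (rotGrad u v p q) (rotGrad u v p' q') =
      p * p' * ‖v‖ ^ 2 - (p * q' + q * p') * inner ℝ u v + q * q' * ‖u‖ ^ 2 := by
  simp only [rotGrad, inner_sub_left, inner_sub_right, real_inner_smul_left, real_inner_smul_right]
  rw [real_inner_self_eq_norm_sq, real_inner_self_eq_norm_sq, real_inner_comm u v]
  ring

lemma triJac_pos {p : Fin 3 → E3} (hp : AffineIndependent ℝ p) :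
    0 < triJac (p 0) (p 1) (p 2) := by
  refine Real.sqrt_pos.2 (lt_of_le_of_ne (gram_nonneg _ _) fun h => ?_)
  have hli := (affineIndependent_iff_linearIndependent_vsub ℝ p 0).1 hp
  have h1 : p 1 - p 0 ≠ 0 := sub_ne_zero.2 (hp.injective.ne (by decide))
  -- equality in Cauchy-Schwarz forces a linear relation between the two edges
  set u := p 1 - p 0
  set v := p 2 - p 0
  have hrel : ‖u‖ ^ 2 • v - (inner ℝ u v : ℝ) • u = 0 := by
    rw [← norm_eq_zero, ← sq_eq_zero_iff, ← real_inner_self_eq_norm_sq, inner_rotGrad_rotGrad]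
    linear_combination -‖u‖ ^ 2 * h
  have := Fintype.linearIndependent_iff.1 hli
    (fun i => if i.1 = 2 then ‖u‖ ^ 2 else -(inner ℝ u v : ℝ)) (by
      rw [← Finset.sum_subtype (Finset.univ.erase (0 : Fin 3)) (p := fun i => i ≠ 0)
        (f := fun i => (if i = 2 then ‖u‖ ^ 2 else -(inner ℝ u v : ℝ)) • (p i -ᵥ p 0)) (by simp)]
      rw [show Finset.univ.erase (0 : Fin 3) = {1, 2} by decide, Finset.sum_pair (by decide)]
      simp only [vsub_eq_sub, if_true, show ((1 : Fin 3) = 2) = False by decide, if_false, neg_smul]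
      rw [add_comm, ← sub_eq_add_neg]; exact hrel) ⟨2, by decide⟩
  simp only [if_true] at this
  exact h1 (by simpa using this)

lemma inner_triGrad_fst {a b c : E3} (h : triJac a b c ≠ 0) (η : E3 → ℝ) :
    inner ℝ (triGrad a b c η) (b - a) = η b - η a := by
  have hs := triJac_sq a b c
  have h2 : triJac a b c ^ 2 ≠ 0 := pow_ne_zero 2 h
  rw [triGrad, real_inner_smul_left, inner_add_left, real_inner_smul_left, real_inner_smul_left,
    real_inner_self_eq_norm_sq, real_inner_comm (b - a) (c - a), inv_mul_eq_iff_eq_mul₀ h2, hs]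
  ring

lemma inner_triGrad_snd {a b c : E3} (h : triJac a b c ≠ 0) (η : E3 → ℝ) :
    inner ℝ (triGrad a b c η) (c - a) = η c - η a := by
  have hs := triJac_sq a b c
  have h2 : triJac a b c ^ 2 ≠ 0 := pow_ne_zero 2 h
  rw [triGrad, real_inner_smul_left, inner_add_left, real_inner_smul_left, real_inner_smul_left,
    real_inner_self_eq_norm_sq, inv_mul_eq_iff_eq_mul₀ h2, hs]
  ring

/-- Rotation by a right angle is an isometry, so tangential gradients can be replaced by
`rotGrad`, which depends polynomially on the vertices. -/
lemma inner_triGrad_triGrad {a b c : E3} (h : triJac a b c ≠ 0) (η ζ : E3 → ℝ) :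
    inner ℝ (triGrad a b c η) (triGrad a b c ζ) =
      (triJac a b c ^ 2)⁻¹ * inner ℝ (rotGrad (b - a) (c - a) (η b - η a) (η c - η a))
        (rotGrad (b - a) (c - a) (ζ b - ζ a) (ζ c - ζ a)) := by
  conv_lhs => rw [triGrad.eq_1 a b c ζ]
  rw [real_inner_smul_right, inner_add_right, real_inner_smul_right, real_inner_smul_right,
    inner_triGrad_fst h, inner_triGrad_snd h]
  rw [inner_rotGrad_rotGrad]
  ring

/-- Control of the differences of vertex values by the gradient: the component of
`p • v - q • u` orthogonal to the edge `u` is the height over `u` times `p`. -/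
lemma triJac_mul_le_norm_rotGrad (a b c : E3) (p q : ℝ) :
    triJac a b c * |p| ≤ ‖b - a‖ * ‖rotGrad (b - a) (c - a) p q‖ ∧
    triJac a b c * |q| ≤ ‖c - a‖ * ‖rotGrad (b - a) (c - a) p q‖ := by
  have hs := triJac_sq a b c
  have hX : ‖rotGrad (b - a) (c - a) p q‖ ^ 2 =
      p ^ 2 * ‖c - a‖ ^ 2 - 2 * p * q * inner ℝ (b - a) (c - a) + q ^ 2 * ‖b - a‖ ^ 2 := by
    rw [← real_inner_self_eq_norm_sq, inner_rotGrad_rotGrad]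
    ring
  constructor
  · refine abs_le_of_sq_le_sq' ?_ (by positivity) |>.2
    rw [mul_pow, mul_pow, sq_abs, hs, hX]
    nlinarith [sq_nonneg (q * ‖b - a‖ ^ 2 - p * inner ℝ (b - a) (c - a))]
  · refine abs_le_of_sq_le_sq' ?_ (by positivity) |>.2
    rw [mul_pow, mul_pow, sq_abs, hs, hX]
    nlinarith [sq_nonneg (p * ‖c - a‖ ^ 2 - q * inner ℝ (b - a) (c - a))]

/-- The vertex quadrature rule is exact for affine functions. Only the values on the closed
triangle, in barycentric coordinates, enter the hypothesis. -/
lemma triIntegral_of_affine {a b c : E3} {f : E3 → ℝ} {α β γ : ℝ}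
    (hf : ∀ s r : ℝ, 0 ≤ s → 0 ≤ r → s + r ≤ 1 →
      f (a + s • (b - a) + r • (c - a)) = (1 - s - r) * α + s * β + r * γ) :
    triIntegral a b c f = triJac a b c * ((α + β + γ) / 6) := by
  have inner_int : ∀ s ∈ uIcc (0 : ℝ) 1,
      ∫ r in (0 : ℝ)..(1 - s), f (a + s • (b - a) + r • (c - a)) =
        ((α + γ) / 2) + (β - α - γ) * s + ((α + γ) / 2 - β) * s ^ 2 := by
    intro s hs
    rw [uIcc_of_le zero_le_one] at hs
    have : ∫ r in (0 : ℝ)..(1 - s), f (a + s • (b - a) + r • (c - a)) =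
        ∫ r in (0 : ℝ)..(1 - s), (((1 - s) * α + s * β) + (γ - α) * r) := by
      refine intervalIntegral.integral_congr fun r hr => ?_
      rw [uIcc_of_le (by linarith [hs.2])] at hr
      rw [hf s r hs.1 hr.1 (by linarith [hr.2])]
      ring
    rw [this, intervalIntegral.integral_add (by simp) (by
      exact (continuous_const.mul continuous_id).intervalIntegrable _ _),
      intervalIntegral.integral_const_mul, integral_id, intervalIntegral.integral_const]
    simp only [smul_eq_mul]
    ring
  rw [triIntegral, intervalIntegral.integral_congr inner_int]
  congr 1
  rw [intervalIntegral.integral_add, intervalIntegral.integral_add,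
    intervalIntegral.integral_const_mul, intervalIntegral.integral_const_mul, integral_id,
    integral_pow, intervalIntegral.integral_const]
  · simp only [smul_eq_mul]
    norm_num
    ring
  all_goals exact Continuous.intervalIntegrable (by fun_prop) _ _

lemma triIntegral_const (a b c : E3) (κ : ℝ) :
    triIntegral a b c (fun _ => κ) = triJac a b c * (κ / 2) := by
  rw [triIntegral_of_affine (α := κ) (β := κ) (γ := κ) (fun s r _ _ _ => by ring)]
  ring

/-- The diameter of an inscribed ball is at most the height of the triangle over an edge. -/
lemma inballDiam_mul_le {p : Fin 3 → E3} (hp : AffineIndependent ℝ p) :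
    inballDiam (convexHull ℝ (range p)) * ‖p 1 - p 0‖ ≤ triJac (p 0) (p 1) (p 2) := by
  have hJ := triJac_pos hp
  have hne : p 1 - p 0 ≠ 0 := sub_ne_zero.2 (hp.injective.ne (by decide))
  have h1 : 0 < ‖p 1 - p 0‖ := norm_pos_iff.2 hne
  have h02 : p 0 ≠ p 2 := hp.injective.ne (by decide)
  have h12 : p 1 ≠ p 2 := hp.injective.ne (by decide)
  rw [← le_div_iff₀ h1]
  refine Real.sSup_le ?_ (by positivity)
  rintro d ⟨x, hx, r, hr, rfl, hball⟩
  -- the gradient of the barycentric coordinate of the third vertex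
  set g : E3 := triGrad (p 0) (p 1) (p 2) (fun y => if y = p 2 then 1 else 0) with hg
  have hg1 : inner ℝ g (p 1 - p 0) = (0 : ℝ) := by
    rw [hg, inner_triGrad_fst hJ.ne']; simp [h02, h12]
  have hg2 : inner ℝ g (p 2 - p 0) = (1 : ℝ) := by
    rw [hg, inner_triGrad_snd hJ.ne']; simp [h02]
  have hgn : ‖g‖ = ‖p 1 - p 0‖ / triJac (p 0) (p 1) (p 2) := by
    rw [← sq_eq_sq₀ (norm_nonneg _) (by positivity), ← real_inner_self_eq_norm_sq, hg,
      inner_triGrad_triGrad hJ.ne']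
    simp only [h02, h12, if_true, if_false, rotGrad, sub_self, zero_smul, zero_sub, sub_zero,
      one_smul, inner_neg_neg, real_inner_self_eq_norm_sq]
    rw [div_pow, inv_mul_eq_div]
  have hgpos : 0 < ‖g‖ := by rw [hgn]; positivity
  have hK : ∀ y ∈ convexHull ℝ (range p), inner ℝ g (y - p 0) ∈ Icc (0 : ℝ) 1 := by
    have hconv : Convex ℝ {y : E3 | inner ℝ g (y - p 0) ∈ Icc (0 : ℝ) 1} := by
      have := (convex_Icc (0 : ℝ) 1).affine_preimage
        ((innerₛₗ ℝ g).toAffineMap.comp (AffineEquiv.vaddConst ℝ (p 0)).symm.toAffineMap)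
      exact this
    refine convexHull_min ?_ hconv
    rintro _ ⟨j, rfl⟩
    fin_cases j
    · change inner ℝ g (p 0 - p 0) ∈ Icc (0 : ℝ) 1; simp
    · change inner ℝ g (p 1 - p 0) ∈ Icc (0 : ℝ) 1; rw [hg1]; simp
    · change inner ℝ g (p 2 - p 0) ∈ Icc (0 : ℝ) 1; rw [hg2]; simp
  have hdir : g ∈ (affineSpan ℝ (convexHull ℝ (range p))).direction := by
    have hv : ∀ i, p i - p 0 ∈ (affineSpan ℝ (convexHull ℝ (range p))).direction := fun i =>
      AffineSubspace.vsub_mem_direction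
        (subset_affineSpan ℝ _ (subset_convexHull ℝ _ (mem_range_self i)))
        (subset_affineSpan ℝ _ (subset_convexHull ℝ _ (mem_range_self 0)))
    exact Submodule.smul_mem _ _ (Submodule.add_mem _ (Submodule.smul_mem _ _ (hv 1))
      (Submodule.smul_mem _ _ (hv 2)))
  have hmem : ∀ κ : ℝ, |κ| * ‖g‖ ≤ r → x + κ • g ∈ convexHull ℝ (range p) := fun κ hκ => by
    refine hball ⟨?_, ?_⟩
    · simpa [Metric.mem_closedBall, dist_eq_norm, norm_smul] using hκ
    · rw [add_comm]
      exact AffineSubspace.vadd_mem_of_mem_direction (Submodule.smul_mem _ _ hdir)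
        (subset_affineSpan ℝ _ hx)
  have hκ : |r / ‖g‖| * ‖g‖ ≤ r := by
    rw [abs_of_nonneg (by positivity), div_mul_cancel₀ _ hgpos.ne']
  have hplus := (hK _ (hmem (r / ‖g‖) hκ)).2
  have hminus := (hK _ (hmem (-(r / ‖g‖)) (by rwa [abs_neg]))).1
  have e1 : ∀ κ : ℝ, inner ℝ g (x + κ • g - p 0) = inner ℝ g (x - p 0) + κ * ‖g‖ ^ 2 := by
    intro κ
    rw [add_sub_right_comm, inner_add_right, real_inner_smul_right, real_inner_self_eq_norm_sq]
  rw [e1] at hplus hminus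
  have e2 : r / ‖g‖ * ‖g‖ ^ 2 = r * ‖g‖ := by field_simp
  have : 2 * (r * ‖g‖) ≤ 1 := by rw [← e2]; linarith
  rw [hgn] at this
  rw [le_div_iff₀ h1]
  have h3 : 2 * (r * (‖p 1 - p 0‖ / triJac (p 0) (p 1) (p 2))) =
    2 * r * ‖p 1 - p 0‖ / triJac (p 0) (p 1) (p 2) := by ring
  rw [h3, div_le_one hJ] at this
  exact this

/-! ### Barycentric coordinates and nodal functions -/

lemma exists_weights_of_mem_convexHull {ι : Type*} [Fintype ι] {f : ι → E3} {s : Set ι} {x : E3}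
    (hx : x ∈ convexHull ℝ (f '' s)) :
    ∃ w : ι → ℝ, (∀ i, 0 ≤ w i) ∧ ∑ i, w i = 1 ∧ (∀ i, i ∉ s → w i = 0) ∧
      ∑ i, w i • f i = x := by
  classical
  let C : Set E3 := {x | ∃ w : ι → ℝ, (∀ i, 0 ≤ w i) ∧ ∑ i, w i = 1 ∧ (∀ i, i ∉ s → w i = 0) ∧
      ∑ i, w i • f i = x}
  have hC : Convex ℝ C := by
    rintro _ ⟨v, hv0, hv1, hvs, rfl⟩ _ ⟨w, hw0, hw1, hws, rfl⟩ α β hα hβ hαβ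
    refine ⟨fun i => α * v i + β * w i, fun i => ?_, ?_, fun i hi => ?_, ?_⟩
    · have := hv0 i; have := hw0 i; positivity
    · rw [Finset.sum_add_distrib, ← Finset.mul_sum, ← Finset.mul_sum, hv1, hw1]; linarith
    · simp [hvs i hi, hws i hi]
    · simp only [add_smul, mul_smul, Finset.sum_add_distrib, Finset.smul_sum]
  refine convexHull_min ?_ hC hx
  rintro _ ⟨i, hi, rfl⟩
  refine ⟨Pi.single i 1, fun j => ?_, by simp, fun j hj => ?_, ?_⟩
  · by_cases h : j = i
    · subst h; simp
    · simp [h]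
  · rw [Pi.single_eq_of_ne]; rintro rfl; exact hj hi
  · simp [Pi.single_apply]

namespace EvolvingMesh

variable {T : ℝ} {S : EvolvingSurface T} (M : EvolvingMesh S)

lemma elem_eq (K : Fin M.numTris) (t : ℝ) :
    M.elem K t = convexHull ℝ ((fun i => M.node i t) '' range (M.vert K)) := by
  rw [elem, ← range_comp]; rfl

/-- The weights, on all nodes, of the point with coordinates `c` on the triangle `K`. -/
noncomputable def triWeight (K : Fin M.numTris) (c : Fin 3 → ℝ) (i : Fin M.numNodes) : ℝ :=
  ∑ j, if M.vert K j = i then c j else 0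

variable {M}

lemma sum_triWeight_smul {E : Type*} [AddCommGroup E] [Module ℝ E] (K : Fin M.numTris)
    (c : Fin 3 → ℝ) (f : Fin M.numNodes → E) :
    ∑ i, M.triWeight K c i • f i = ∑ j, c j • f (M.vert K j) := by
  simp only [triWeight, Finset.sum_smul]
  rw [Finset.sum_comm]
  refine Finset.sum_congr rfl fun j _ => ?_
  simp [ite_smul]

lemma triWeight_eq_zero {K : Fin M.numTris} {c : Fin 3 → ℝ} {i : Fin M.numNodes}
    (hi : i ∉ range (M.vert K)) : M.triWeight K c i = 0 :=
  Finset.sum_eq_zero fun j _ => if_neg fun h => hi ⟨j, h⟩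

lemma isBary_triWeight (K : Fin M.numTris) (t : ℝ) {c : Fin 3 → ℝ} (h0 : ∀ j, 0 ≤ c j)
    (h1 : ∑ j, c j = 1) : M.IsBary t (∑ j, c j • M.vertex K t j) (M.triWeight K c) := by
  refine ⟨K, fun i => Finset.sum_nonneg fun j _ => ?_, ?_, fun i hi => triWeight_eq_zero hi,
    sum_triWeight_smul K c fun i => M.node i t⟩
  · split_ifs
    exacts [h0 j, le_rfl]
  · simpa [h1] using sum_triWeight_smul K c fun _ => (1 : ℝ)

lemma isBary_of_mem {t : ℝ} {K : Fin M.numTris} {x : E3} (hx : x ∈ M.elem K t) :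
    ∃ w : Fin M.numNodes → ℝ, (∀ i, 0 ≤ w i) ∧ ∑ i, w i = 1 ∧
      (∀ i, i ∉ range (M.vert K) → w i = 0) ∧ ∑ i, w i • M.node i t = x := by
  rw [elem_eq] at hx
  exact exists_weights_of_mem_convexHull hx

lemma mem_elem_of_weights {t : ℝ} {K : Fin M.numTris} {w : Fin M.numNodes → ℝ}
    (h0 : ∀ i, 0 ≤ w i) (h1 : ∑ i, w i = 1) (hw : ∀ i, i ∉ range (M.vert K) → w i = 0) :
    ∑ i, w i • M.node i t ∈ M.elem K t := by
  rw [← Fintype.sum_of_injective (M.vert K) (M.vert_injective K)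
      (fun j => w (M.vert K j) • M.vertex K t j) _ (fun i hi => by simp [hw i hi])
      (fun j => rfl)]
  refine (convex_convexHull ℝ _).sum_mem (fun j _ => h0 _) ?_
    (fun j _ => subset_convexHull ℝ _ (mem_range_self j))
  rw [← h1]
  exact Fintype.sum_of_injective (M.vert K) (M.vert_injective K) _ _ hw (fun j => rfl)

lemma weights_unique {t : ℝ} {K : Fin M.numTris} (hK : AffineIndependent ℝ (M.vertex K t))
    {v w : Fin M.numNodes → ℝ} (hv1 : ∑ i, v i = 1) (hw1 : ∑ i, w i = 1)
    (hv : ∀ i, i ∉ range (M.vert K) → v i = 0) (hw : ∀ i, i ∉ range (M.vert K) → w i = 0)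
    (h : ∑ i, v i • M.node i t = ∑ i, w i • M.node i t) : v = w := by
  have key := (affineIndependent_iff (k := ℝ)).1 hK Finset.univ
    (fun j => v (M.vert K j) - w (M.vert K j)) (by
      rw [Fintype.sum_of_injective (M.vert K) (M.vert_injective K) _ (fun i => v i - w i)
        (fun i hi => by simp [hv i hi, hw i hi]) (fun j => rfl)]
      simp [hv1, hw1]) (by
      rw [Fintype.sum_of_injective (M.vert K) (M.vert_injective K)
        (fun j => (v (M.vert K j) - w (M.vert K j)) • M.vertex K t j)
        (fun i => (v i - w i) • M.node i t)
        (fun i hi => by simp [hv i hi, hw i hi]) (fun j => rfl)]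
      simp [sub_smul, h])
  funext i
  by_cases hi : i ∈ range (M.vert K)
  · obtain ⟨j, rfl⟩ := hi
    exact sub_eq_zero.1 (key j (Finset.mem_univ j))
  · rw [hv i hi, hw i hi]

variable {ρ t : ℝ}

/-- Barycentric coordinates do not depend on the triangle used: a point of two triangles lies in
the hull of their common vertices, by conformity. -/
lemma isBary_unique (hM : M.IsAdmissible ρ) (ht : t ∈ Icc 0 T) {x : E3} {v w : Fin M.numNodes → ℝ}
    (hv : M.IsBary t x v) (hw : M.IsBary t x w) : v = w := by
  obtain ⟨K, hv0, hv1, hvs, hvx⟩ := hv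
  obtain ⟨L, hw0, hw1, hws, hwx⟩ := hw
  have hx : x ∈ M.elem K t ∩ M.elem L t :=
    ⟨hvx ▸ mem_elem_of_weights hv0 hv1 hvs, hwx ▸ mem_elem_of_weights hw0 hw1 hws⟩
  rw [hM.conforming t ht K L] at hx
  obtain ⟨u, -, hu1, hus, hux⟩ := exists_weights_of_mem_convexHull hx
  rw [weights_unique (hM.nondegenerate t ht K) hv1 hu1 hvs (fun i hi => hus i fun h => hi h.1)
    (hvx.trans hux.symm)]
  exact weights_unique (hM.nondegenerate t ht L) hu1 hw1 (fun i hi => hus i fun h => hi h.2) hws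
    (hux.trans hwx.symm)

/-- The nodal basis functions, defined through a choice, are computed by any system of
barycentric coordinates. -/
lemma hat_eq (hM : M.IsAdmissible ρ) (ht : t ∈ Icc 0 T)
    {x : E3} {w : Fin M.numNodes → ℝ} (hw : M.IsBary t x w) (i : Fin M.numNodes) :
    M.hat i t x = w i := by
  have h : ∃ w, M.IsBary t x w := ⟨w, hw⟩
  rw [hat, dif_pos h, isBary_unique hM ht h.choose_spec hw]

variable (M) in
/-- The finite element function on `Γ_h(t)` with nodal values `η`. -/
noncomputable def nodal (t : ℝ) (η : Fin M.numNodes → ℝ) (x : E3) : ℝ := ∑ i, η i * M.hat i t x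

lemma nodal_eq (hM : M.IsAdmissible ρ) (ht : t ∈ Icc 0 T)
    (η : Fin M.numNodes → ℝ) {x : E3} {w : Fin M.numNodes → ℝ}
    (hw : M.IsBary t x w) : M.nodal t η x = ∑ i, η i * w i :=
  Finset.sum_congr rfl fun i _ => by rw [hat_eq hM ht hw]

lemma nodal_combination (hM : M.IsAdmissible ρ) (ht : t ∈ Icc 0 T)
    (η : Fin M.numNodes → ℝ) (K : Fin M.numTris) {c : Fin 3 → ℝ}
    (h0 : ∀ j, 0 ≤ c j) (h1 : ∑ j, c j = 1) :
    M.nodal t η (∑ j, c j • M.vertex K t j) = ∑ j, c j * η (M.vert K j) := by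
  rw [nodal_eq hM ht η (isBary_triWeight K t h0 h1)]
  have := sum_triWeight_smul K c η
  simp only [smul_eq_mul] at this
  rw [← this]
  exact Finset.sum_congr rfl fun i _ => mul_comm _ _

lemma nodal_vertex (hM : M.IsAdmissible ρ) (ht : t ∈ Icc 0 T)
    (η : Fin M.numNodes → ℝ) (K : Fin M.numTris) (j : Fin 3) :
    M.nodal t η (M.vertex K t j) = η (M.vert K j) := by
  have := nodal_combination hM ht η K (c := Pi.single j 1)
    (fun k => by by_cases h : k = j <;> simp [h]) (by simp)
  simpa [Pi.single_apply] using this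

lemma nodal_node (hM : M.IsAdmissible ρ) (ht : t ∈ Icc 0 T)
    (η : Fin M.numNodes → ℝ) (i : Fin M.numNodes) :
    M.nodal t η (M.node i t) = η i := by
  obtain ⟨K, j, rfl⟩ := M.node_covered i
  exact nodal_vertex hM ht η K j

lemma node_mem_surf (i : Fin M.numNodes) (t : ℝ) : M.node i t ∈ M.surf t := by
  obtain ⟨K, j, rfl⟩ := M.node_covered i
  exact mem_iUnion.2 ⟨K, subset_convexHull ℝ _ (mem_range_self j)⟩

lemma isCompact_elem (K : Fin M.numTris) (t : ℝ) : IsCompact (M.elem K t) :=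
  (finite_range _).isCompact_convexHull ℝ

lemma isCompact_surf (t : ℝ) : IsCompact (M.surf t) :=
  isCompact_iUnion fun K => isCompact_elem K t

/-- Elementwise affine functions take weighted means of vertices to weighted means of values. -/
lemma apply_of_eqOn_affine {K : Fin M.numTris} {φ : E3 → ℝ} {A : E3 →ᵃ[ℝ] ℝ}
    (hA : EqOn φ A (M.elem K t)) {w : Fin M.numNodes → ℝ} (h0 : ∀ i, 0 ≤ w i)
    (h1 : ∑ i, w i = 1) (hw : ∀ i, i ∉ range (M.vert K) → w i = 0) :
    φ (∑ i, w i • M.node i t) = ∑ i, φ (M.node i t) * w i := by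
  have hdec : ∀ y, A y = A.linear y + A 0 := fun y => congrFun (AffineMap.decomp A) y
  have hval : ∀ i, φ (M.node i t) * w i = w i * A.linear (M.node i t) + w i * A 0 := by
    intro i
    by_cases hi : i ∈ range (M.vert K)
    · obtain ⟨j, rfl⟩ := hi
      rw [hA (subset_convexHull ℝ _ (mem_range_self j) : M.node (M.vert K j) t ∈ _), hdec]
      ring
    · simp [hw i hi]
  rw [hA (mem_elem_of_weights h0 h1 hw), hdec, Finset.sum_congr rfl fun i _ => hval i,
    Finset.sum_add_distrib, ← Finset.sum_mul, h1, one_mul, map_sum]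
  simp

/-- A finite element function is determined on `Γ_h(t)` by its nodal values. -/
lemma eqOn_nodal (hM : M.IsAdmissible ρ) (ht : t ∈ Icc 0 T) {φ : E3 → ℝ} (hφ : φ ∈ M.shape t) :
    EqOn φ (M.nodal t fun i => φ (M.node i t)) (M.surf t) := by
  intro x hx
  obtain ⟨K, hK⟩ := mem_iUnion.1 hx
  obtain ⟨A, hA⟩ := hφ.2 K
  obtain ⟨w, h0, h1, hw, rfl⟩ := isBary_of_mem hK
  rw [nodal_eq hM ht _ ⟨K, h0, h1, hw, rfl⟩, apply_of_eqOn_affine hA h0 h1 hw]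

lemma triJac_vertex_pos (hM : M.IsAdmissible ρ) (ht : t ∈ Icc 0 T) (K : Fin M.numTris) :
    0 < triJac (M.vertex K t 0) (M.vertex K t 1) (M.vertex K t 2) :=
  triJac_pos (hM.nondegenerate t ht K)

lemma nodal_mem_shape (hM : M.IsAdmissible ρ) (ht : t ∈ Icc 0 T)
    (η : Fin M.numNodes → ℝ) : M.nodal t η ∈ M.shape t := by
  have haff : ∀ K, ∃ A : E3 →ᵃ[ℝ] ℝ, EqOn (M.nodal t η) A (M.elem K t) := by
    intro K
    have hJ := (triJac_vertex_pos hM ht K).ne'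
    set g := M.elemGrad K t (M.nodal t η) with hg
    refine ⟨AffineMap.const ℝ E3 (M.nodal t η (M.vertex K t 0) - inner ℝ g (M.vertex K t 0)) +
      ((innerₛₗ ℝ g : E3 →ₗ[ℝ] ℝ).toAffineMap), fun x hx => ?_⟩
    have hgj : ∀ j, inner ℝ g (M.vertex K t j) =
        η (M.vert K j) - η (M.vert K 0) + inner ℝ g (M.vertex K t 0) := by
      intro j
      have e1 : inner ℝ g (M.vertex K t 1 - M.vertex K t 0) = _ := inner_triGrad_fst hJ _
      have e2 : inner ℝ g (M.vertex K t 2 - M.vertex K t 0) = _ := inner_triGrad_snd hJ _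
      rw [inner_sub_right, nodal_vertex hM ht, nodal_vertex hM ht] at e1 e2
      fin_cases j
      · simp
      · change inner ℝ g (M.vertex K t 1) = η (M.vert K 1) - _ + _; linarith
      · change inner ℝ g (M.vertex K t 2) = η (M.vert K 2) - _ + _; linarith
    obtain ⟨w, h0, h1, hw, rfl⟩ := isBary_of_mem hx
    rw [nodal_eq hM ht η ⟨K, h0, h1, hw, rfl⟩]
    change _ = (M.nodal t η (M.vertex K t 0) - inner ℝ g (M.vertex K t 0)) + inner ℝ g _
    have hval : ∀ i, η i * w i = w i * inner ℝ g (M.node i t) +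
        w i * (η (M.vert K 0) - inner ℝ g (M.vertex K t 0)) := by
      intro i
      by_cases hi : i ∈ range (M.vert K)
      · obtain ⟨j, rfl⟩ := hi
        have : inner ℝ g (M.node (M.vert K j) t) = _ := hgj j
        rw [this]
        ring
      · simp [hw i hi]
    rw [Finset.sum_congr rfl fun i _ => hval i, Finset.sum_add_distrib, ← Finset.sum_mul, h1,
      nodal_vertex hM ht, inner_sum]
    simp only [real_inner_smul_right]
    ring
  refine ⟨?_, haff⟩
  refine (locallyFinite_of_finite _).continuousOn_iUnion
    (fun K => (isCompact_elem K t).isClosed) fun K => ?_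
  obtain ⟨A, hA⟩ := haff K
  exact A.continuous_of_finiteDimensional.continuousOn.congr hA

lemma combination_eq_param (K : Fin M.numTris) (t s r : ℝ) :
    M.vertex K t 0 + s • (M.vertex K t 1 - M.vertex K t 0) +
      r • (M.vertex K t 2 - M.vertex K t 0) =
    ∑ j, (![1 - s - r, s, r] : Fin 3 → ℝ) j • M.vertex K t j := by
  simp only [Fin.sum_univ_three, Matrix.cons_val_zero, Matrix.cons_val_one, Matrix.cons_val]
  module

/-! ### Nodal form of the integrals and bilinear forms -/

variable (M) in
/-- The Jacobian of the triangle `K(t)`: twice its area. -/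
noncomputable def jac (K : Fin M.numTris) (t : ℝ) : ℝ :=
  triJac (M.vertex K t 0) (M.vertex K t 1) (M.vertex K t 2)

variable (M) in
/-- The lumped mass `∫ φ_i` of the node `i`. -/
noncomputable def mass (t : ℝ) (i : Fin M.numNodes) : ℝ :=
  ∑ K, M.jac K t / 6 * M.triWeight K 1 i

variable (M) in
/-- The weighted mass `∫ φ_i ∇_{Γ_h} · V_h` of the node `i`, which is also the time derivative of
the lumped mass. -/
noncomputable def massDeriv (t : ℝ) (i : Fin M.numNodes) : ℝ :=
  ∑ K, M.jac K t * M.elemDiv K t / 6 * M.triWeight K 1 i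

lemma sum_sum_triWeight (c : Fin M.numTris → ℝ) (f : Fin M.numNodes → ℝ) :
    ∑ i, (∑ K, c K * M.triWeight K 1 i) * f i = ∑ K, c K * ∑ j, f (M.vert K j) := by
  simp only [Finset.sum_mul]
  rw [Finset.sum_comm]
  refine Finset.sum_congr rfl fun K _ => ?_
  have := sum_triWeight_smul K 1 f
  simp only [smul_eq_mul, Pi.one_apply, one_mul] at this
  rw [← this, Finset.mul_sum]
  exact Finset.sum_congr rfl fun i _ => mul_assoc _ _ _

lemma triIntegral_shape_mul (hM : M.IsAdmissible ρ) (ht : t ∈ Icc 0 T)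
    {φ : E3 → ℝ} (hφ : φ ∈ M.shape t) (K : Fin M.numTris) (κ : ℝ) :
    triIntegral (M.vertex K t 0) (M.vertex K t 1) (M.vertex K t 2) (fun x => φ x * κ) =
      M.jac K t * κ / 6 * ∑ j, φ (M.vertex K t j) := by
  rw [triIntegral_of_affine (α := φ (M.vertex K t 0) * κ) (β := φ (M.vertex K t 1) * κ)
    (γ := φ (M.vertex K t 2) * κ), Fin.sum_univ_three, jac]
  · ring
  intro s r hs hr hsr
  have h0 : ∀ j, 0 ≤ (![1 - s - r, s, r] : Fin 3 → ℝ) j := by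
    intro j; fin_cases j
    · change 0 ≤ 1 - s - r; linarith
    exacts [hs, hr]
  have h1 : ∑ j, (![1 - s - r, s, r] : Fin 3 → ℝ) j = 1 := by
    rw [Fin.sum_univ_three]; change 1 - s - r + s + r = 1; ring
  have hmem : ∑ j, (![1 - s - r, s, r] : Fin 3 → ℝ) j • M.vertex K t j ∈ M.surf t := by
    obtain ⟨L, hw0, hw1, hws, hwx⟩ := isBary_triWeight K t h0 h1
    rw [← hwx]
    exact mem_iUnion.2 ⟨L, mem_elem_of_weights hw0 hw1 hws⟩
  rw [combination_eq_param, eqOn_nodal hM ht hφ hmem, nodal_combination hM ht _ K h0 h1]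
  simp only [Fin.sum_univ_three, Matrix.cons_val_zero, Matrix.cons_val_one, Matrix.cons_val]
  change ((1 - s - r) * φ (M.vertex K t 0) + s * φ (M.vertex K t 1) +
    r * φ (M.vertex K t 2)) * κ = _
  ring

lemma integral_shape (hM : M.IsAdmissible ρ) (ht : t ∈ Icc 0 T) {φ : E3 → ℝ} (hφ : φ ∈ M.shape t) :
    (M.integral t fun _ => φ) = ∑ i, M.mass t i * φ (M.node i t) := by
  rw [show (fun i => M.mass t i * φ (M.node i t)) =
    fun i => (∑ K, M.jac K t / 6 * M.triWeight K 1 i) * φ (M.node i t) from rfl,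
    sum_sum_triWeight, integral]
  refine Finset.sum_congr rfl fun K _ => ?_
  have := triIntegral_shape_mul hM ht hφ K 1
  simp only [mul_one] at this
  exact this

lemma lumped_eq (hM : M.IsAdmissible ρ) (ht : t ∈ Icc 0 T) (η ζ : E3 → ℝ) :
    M.lumped t η ζ = ∑ i, M.mass t i * (η (M.node i t) * ζ (M.node i t)) := by
  have h := integral_shape hM ht
    (nodal_mem_shape hM ht fun i => η (M.node i t) * ζ (M.node i t))
  simp only [nodal_node hM ht] at h
  exact h

/-- The form `g_h(I_h η, 1)` is diagonal, with the derivatives of the lumped masses as weights. -/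
lemma gForm_interp_one (hM : M.IsAdmissible ρ) (ht : t ∈ Icc 0 T) (η : E3 → ℝ) :
    M.gForm t (M.interp t η) 1 = ∑ i, M.massDeriv t i * η (M.node i t) := by
  have hs : M.interp t η ∈ M.shape t := nodal_mem_shape hM ht fun i => η (M.node i t)
  rw [show (fun i => M.massDeriv t i * η (M.node i t)) =
    fun i => (∑ K, M.jac K t * M.elemDiv K t / 6 * M.triWeight K 1 i) * η (M.node i t) from rfl,
    sum_sum_triWeight, gForm, integral]
  refine Finset.sum_congr rfl fun K _ => ?_
  simp only [Pi.one_apply, mul_one]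
  rw [triIntegral_shape_mul hM ht hs K]
  congr 1
  exact Finset.sum_congr rfl fun j _ => nodal_vertex hM ht _ K j

lemma integral_one_pos (hJ : ∀ K, 0 < M.jac K t) (K₀ : Fin M.numTris) :
    0 < M.integral t fun _ _ => 1 := by
  simp only [integral, triIntegral_const]
  exact Finset.sum_pos (fun K _ => mul_pos (hJ K) (by norm_num)) ⟨K₀, Finset.mem_univ _⟩

lemma mass_pos (hM : M.IsAdmissible ρ) (ht : t ∈ Icc 0 T)
    (i : Fin M.numNodes) : 0 < M.mass t i := by
  obtain ⟨K, j, hj⟩ := M.node_covered i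
  have hnn : ∀ L, 0 ≤ M.triWeight L 1 i := fun L => Finset.sum_nonneg fun k _ => by
    split_ifs <;> simp
  refine Finset.sum_pos' (fun L _ => mul_nonneg
    (div_nonneg (triJac_nonneg _ _ _) (by norm_num)) (hnn L)) ⟨K, Finset.mem_univ _, ?_⟩
  refine mul_pos (div_pos (triJac_vertex_pos hM ht K) (by norm_num)) ?_
  refine Finset.sum_pos' (fun k _ => by split_ifs <;> simp) ⟨j, Finset.mem_univ _, ?_⟩
  simp [hj]

variable (M) in
/-- The rotated, scaled gradient on `K(t)` of the finite element function with nodal values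
`η`. -/
noncomputable def nodalRot (K : Fin M.numTris) (t : ℝ) (η : Fin M.numNodes → ℝ) : E3 :=
  rotGrad (M.vertex K t 1 - M.vertex K t 0) (M.vertex K t 2 - M.vertex K t 0)
    (η (M.vert K 1) - η (M.vert K 0)) (η (M.vert K 2) - η (M.vert K 0))

variable (M) in
/-- The form `a_h` in terms of nodal values. -/
noncomputable def stiffForm (t : ℝ) (η ζ : Fin M.numNodes → ℝ) : ℝ :=
  ∑ K, (2 * M.jac K t)⁻¹ * inner ℝ (M.nodalRot K t η) (M.nodalRot K t ζ)

lemma aForm_eq (hM : M.IsAdmissible ρ) (ht : t ∈ Icc 0 T) (η ζ : E3 → ℝ) :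
    M.aForm t η ζ = M.stiffForm t (fun i => η (M.node i t)) (fun i => ζ (M.node i t)) := by
  rw [aForm, integral, stiffForm]
  refine Finset.sum_congr rfl fun K _ => ?_
  have hJ := (triJac_vertex_pos hM ht K).ne'
  rw [triIntegral_const, elemGrad, elemGrad, inner_triGrad_triGrad hJ]
  simp only [jac, nodalRot]
  change _ * (_ * inner ℝ (rotGrad (M.vertex K t 1 - M.vertex K t 0)
    (M.vertex K t 2 - M.vertex K t 0) (η (M.vertex K t 1) - η (M.vertex K t 0))
    (η (M.vertex K t 2) - η (M.vertex K t 0))) (rotGrad (M.vertex K t 1 - M.vertex K t 0)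
    (M.vertex K t 2 - M.vertex K t 0) (ζ (M.vertex K t 1) - ζ (M.vertex K t 0))
    (ζ (M.vertex K t 2) - ζ (M.vertex K t 0))) / 2) = _ * inner ℝ (rotGrad _ _
    (η (M.vertex K t 1) - η (M.vertex K t 0)) (η (M.vertex K t 2) - η (M.vertex K t 0)))
    (rotGrad _ _ (ζ (M.vertex K t 1) - ζ (M.vertex K t 0))
    (ζ (M.vertex K t 2) - ζ (M.vertex K t 0)))
  field_simp

lemma gradNormSq_eq (hM : M.IsAdmissible ρ) (ht : t ∈ Icc 0 T) (η : E3 → ℝ) :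
    M.gradNormSq t η = M.stiffForm t (fun i => η (M.node i t)) (fun i => η (M.node i t)) := by
  rw [← aForm_eq hM ht]
  simp only [gradNormSq, aForm, real_inner_self_eq_norm_sq]

variable (M) in
/-- The stiffness matrix. -/
noncomputable def stiffMatrix (t : ℝ) : Matrix (Fin M.numNodes) (Fin M.numNodes) ℝ :=
  Matrix.of fun i j => M.stiffForm t (Pi.single i 1) (Pi.single j 1)

lemma nodalRot_eq_sum (K : Fin M.numTris) (t : ℝ) (η : Fin M.numNodes → ℝ) :
    M.nodalRot K t η = ∑ i, η i • M.nodalRot K t (Pi.single i 1) := by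
  have hv : ∀ k, ∑ i, η i * (Pi.single i 1 : Fin M.numNodes → ℝ) k = η k := fun k => by
    simp [Pi.single_apply]
  simp only [nodalRot, rotGrad, smul_sub, Finset.sum_sub_distrib, smul_smul, mul_sub,
    ← Finset.sum_smul, hv]

lemma dotProduct_stiffMatrix (t : ℝ) (η ζ : Fin M.numNodes → ℝ) :
    η ⬝ᵥ (M.stiffMatrix t).mulVec ζ = M.stiffForm t η ζ := by
  have hK : ∀ K, (2 * M.jac K t)⁻¹ * inner ℝ (M.nodalRot K t η) (M.nodalRot K t ζ) =
      ∑ i, ∑ j, η i * ((2 * M.jac K t)⁻¹ * inner ℝ (M.nodalRot K t (Pi.single i 1))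
        (M.nodalRot K t (Pi.single j 1)) * ζ j) := by
    intro K
    rw [nodalRot_eq_sum K t η, nodalRot_eq_sum K t ζ, sum_inner, Finset.mul_sum]
    refine Finset.sum_congr rfl fun i _ => ?_
    rw [inner_sum, Finset.mul_sum]
    refine Finset.sum_congr rfl fun j _ => ?_
    rw [real_inner_smul_left, real_inner_smul_right]
    ring
  rw [stiffForm, Finset.sum_congr rfl fun K _ => hK K, Finset.sum_comm]
  simp only [dotProduct, Matrix.mulVec, stiffMatrix, Matrix.of_apply, stiffForm]
  refine Finset.sum_congr rfl fun i _ => ?_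
  rw [Finset.sum_comm, Finset.mul_sum]
  refine Finset.sum_congr rfl fun j _ => ?_
  rw [Finset.sum_mul, Finset.mul_sum]

lemma stiffForm_comm (t : ℝ) (η ζ : Fin M.numNodes → ℝ) :
    M.stiffForm t η ζ = M.stiffForm t ζ η :=
  Finset.sum_congr rfl fun K _ => by rw [real_inner_comm]

lemma stiffForm_self_nonneg (t : ℝ) (η : Fin M.numNodes → ℝ) : 0 ≤ M.stiffForm t η η :=
  Finset.sum_nonneg fun _ _ => mul_nonneg
    (inv_nonneg.2 (mul_nonneg zero_le_two (triJac_nonneg _ _ _))) real_inner_self_nonneg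

lemma eq_of_stiffForm_self_eq_zero (hM : M.IsAdmissible ρ) (ht : t ∈ Icc 0 T)
    {η : Fin M.numNodes → ℝ} (h : M.stiffForm t η η = 0)
    (K : Fin M.numTris) (j : Fin 3) : η (M.vert K j) = η (M.vert K 0) := by
  have hJ := triJac_vertex_pos hM ht K
  have h0 := (Finset.sum_eq_zero_iff_of_nonneg fun _ _ => mul_nonneg
    (inv_nonneg.2 (mul_nonneg zero_le_two (triJac_nonneg _ _ _))) real_inner_self_nonneg).1 h K
    (Finset.mem_univ K)
  have hX : ‖M.nodalRot K t η‖ = 0 := by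
    rcases mul_eq_zero.1 h0 with h1 | h1
    · rw [inv_eq_zero] at h1
      exact absurd h1 (mul_pos two_pos hJ).ne'
    · exact norm_eq_zero.2 (inner_self_eq_zero.1 h1)
  have hb := triJac_mul_le_norm_rotGrad (M.vertex K t 0) (M.vertex K t 1) (M.vertex K t 2)
    (η (M.vert K 1) - η (M.vert K 0)) (η (M.vert K 2) - η (M.vert K 0))
  rw [nodalRot] at hX
  rw [hX, mul_zero, mul_zero] at hb
  have aux : ∀ p : ℝ, triJac (M.vertex K t 0) (M.vertex K t 1) (M.vertex K t 2) * |p| ≤ 0 →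
      p = 0 := fun p hp => abs_eq_zero.1 (le_antisymm (by nlinarith [abs_nonneg p]) (abs_nonneg p))
  fin_cases j
  · rfl
  · exact sub_eq_zero.1 (aux _ hb.1)
  · exact sub_eq_zero.1 (aux _ hb.2)

end EvolvingMesh

/-! ### Motion of the triangles -/

/-- A `C¹` field is Lipschitz on each `Γ(t)`, uniformly in `t`, because all the surfaces lie in one
ball. -/
lemma EvolvingSurface.exists_lipschitz {T : ℝ} (S : EvolvingSurface T) :
    ∃ L : ℝ, 0 ≤ L ∧ ∀ t ∈ Icc 0 T, ∀ x ∈ S.surf t, ∀ y ∈ S.surf t,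
      ‖S.velocity t x - S.velocity t y‖ ≤ L * ‖x - y‖ := by
  obtain ⟨V', hV, hk⟩ := S.velocity_regular
  have hcpt : IsCompact ((fun q : ℝ × E3 => S.flow q.1 q.2) '' (Icc 0 T ×ˢ S.Γ₀)) :=
    (isCompact_Icc.prod S.isClosedC2Surface.isCompact).image_of_continuousOn S.flow_continuousOn
  obtain ⟨R, hR⟩ := hcpt.isBounded.subset_closedBall 0
  have hc := ((hk 1 (by norm_num)).1.mono
    (prod_mono_right (subset_univ (Metric.closedBall (0 : E3) R))))
  obtain ⟨L, hL⟩ :=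
    (isCompact_Icc.prod (isCompact_closedBall (0 : E3) R)).exists_bound_of_continuousOn hc
  refine ⟨|L|, abs_nonneg _, fun t ht x hx y hy => ?_⟩
  have hmem : ∀ x ∈ S.surf t, x ∈ Metric.closedBall (0 : E3) R := by
    rintro _ ⟨p, hp, rfl⟩
    exact hR ⟨(t, p), ⟨ht, hp⟩, rfl⟩
  refine (convex_closedBall (0 : E3) R).norm_image_sub_le_of_norm_fderiv_le (𝕜 := ℝ)
    (fun z _ => ((hV t ht).1.differentiable (by norm_num)).differentiableAt) (fun z hz => ?_)
    (hmem y hy) (hmem x hx)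
  rw [← norm_iteratedFDeriv_one]
  exact (hL (t, z) ⟨ht, hz⟩).trans (le_abs_self L)

/-- The tangential divergence on a triangle of the affine interpolant of a vector field `F`. -/
lemma sum_triGrad_apply (a b c : E3) (F : E3 → E3) :
    ∑ k : Fin 3, triGrad a b c (fun x => F x k) k = (triJac a b c ^ 2)⁻¹ *
      (‖c - a‖ ^ 2 * inner ℝ (F b - F a) (b - a)
        - inner ℝ (b - a) (c - a) * inner ℝ (F c - F a) (b - a)
        + ‖b - a‖ ^ 2 * inner ℝ (F c - F a) (c - a)
        - inner ℝ (b - a) (c - a) * inner ℝ (F b - F a) (c - a)) := by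
  have h : ∀ u v : E3, inner ℝ u v = ∑ k, u k * v k := fun u v => by
    rw [PiLp.inner_apply]
    exact Finset.sum_congr rfl fun k _ => by simp [mul_comm]
  rw [h (F b - F a) (b - a), h (F c - F a) (b - a), h (F c - F a) (c - a), h (F b - F a) (c - a)]
  simp only [triGrad, Fin.sum_univ_three, PiLp.smul_apply, PiLp.add_apply, PiLp.sub_apply,
    smul_eq_mul]
  ring

namespace EvolvingMesh

variable {T : ℝ} {S : EvolvingSurface T} {M : EvolvingMesh S} {ρ t : ℝ}

lemma node_mem (i : Fin M.numNodes) (t : ℝ) : M.node i t ∈ S.surf t :=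
  ⟨_, M.node₀_mem i, rfl⟩

lemma hasDerivWithinAt_node (ht : t ∈ Icc 0 T) (i : Fin M.numNodes) :
    HasDerivWithinAt (M.node i) (S.velocity t (M.node i t)) (Icc 0 T) t :=
  S.flow_ode _ (M.node₀_mem i) t ht

lemma continuousOn_node (i : Fin M.numNodes) : ContinuousOn (M.node i) (Icc 0 T) :=
  fun _ ht => (hasDerivWithinAt_node ht i).continuousWithinAt

variable (M) in
/-- The difference of the nodal velocities along the edge from the vertex `0` to the vertex `j`;
the time derivative of that edge. -/
def edgeVel (K : Fin M.numTris) (t : ℝ) (j : Fin 3) : E3 :=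
  S.velocity t (M.vertex K t j) - S.velocity t (M.vertex K t 0)

variable (M) in
/-- The edge from the vertex `0` to the vertex `j`. -/
def edge (K : Fin M.numTris) (t : ℝ) (j : Fin 3) : E3 := M.vertex K t j - M.vertex K t 0

lemma hasDerivWithinAt_edge (ht : t ∈ Icc 0 T) (K : Fin M.numTris) (j : Fin 3) :
    HasDerivWithinAt (fun s => M.edge K s j) (M.edgeVel K t j) (Icc 0 T) t :=
  (hasDerivWithinAt_node ht _).sub (hasDerivWithinAt_node ht _)

lemma jac_pos (hM : M.IsAdmissible ρ) (ht : t ∈ Icc 0 T) (K : Fin M.numTris) : 0 < M.jac K t :=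
  triJac_vertex_pos hM ht K

lemma jac_sq (K : Fin M.numTris) (t : ℝ) : M.jac K t ^ 2 =
    ‖M.edge K t 1‖ ^ 2 * ‖M.edge K t 2‖ ^ 2 - (inner ℝ (M.edge K t 1) (M.edge K t 2)) ^ 2 :=
  triJac_sq _ _ _

lemma discreteVelocity_vertex (hM : M.IsAdmissible ρ) (ht : t ∈ Icc 0 T) (K : Fin M.numTris)
    (j : Fin 3) : M.discreteVelocity t (M.vertex K t j) = S.velocity t (M.vertex K t j) := by
  have hhat : ∀ i, M.hat i t (M.vertex K t j) = (Pi.single i 1 : _ → ℝ) (M.vert K j) := by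
    intro i
    rw [← nodal_vertex hM ht (Pi.single i 1) K j, nodal,
      Finset.sum_eq_single i (fun k _ hk => by rw [Pi.single_eq_of_ne hk, zero_mul]) (by simp)]
    simp
  rw [discreteVelocity, Finset.sum_eq_single (M.vert K j)]
  · rw [hhat, Pi.single_eq_same, one_smul]; rfl
  · intro i _ hi
    rw [hhat, Pi.single_eq_of_ne hi.symm, zero_smul]
  · simp

lemma elemDiv_eq (hM : M.IsAdmissible ρ) (ht : t ∈ Icc 0 T) (K : Fin M.numTris) :
    M.elemDiv K t = (M.jac K t ^ 2)⁻¹ *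
      (‖M.edge K t 2‖ ^ 2 * inner ℝ (M.edgeVel K t 1) (M.edge K t 1)
        - inner ℝ (M.edge K t 1) (M.edge K t 2) * inner ℝ (M.edgeVel K t 2) (M.edge K t 1)
        + ‖M.edge K t 1‖ ^ 2 * inner ℝ (M.edgeVel K t 2) (M.edge K t 2)
        - inner ℝ (M.edge K t 1) (M.edge K t 2) * inner ℝ (M.edgeVel K t 1) (M.edge K t 2)) := by
  have h := sum_triGrad_apply (M.vertex K t 0) (M.vertex K t 1) (M.vertex K t 2)
    (M.discreteVelocity t)
  simp only [discreteVelocity_vertex hM ht] at h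
  exact h

/-- The area of a moving triangle changes at the rate `∇_{Γ_h} · V_h`. -/
lemma hasDerivWithinAt_jac (hM : M.IsAdmissible ρ) (ht : t ∈ Icc 0 T) (K : Fin M.numTris) :
    HasDerivWithinAt (M.jac K) (M.jac K t * M.elemDiv K t) (Icc 0 T) t := by
  have hJ := jac_pos hM ht K
  have h1 := hasDerivWithinAt_edge ht K 1
  have h2 := hasDerivWithinAt_edge ht K 2
  have hg := ((h1.norm_sq.mul h2.norm_sq).sub ((h1.inner ℝ h2).pow 2)).sqrt (by
    have := jac_sq K t
    have h3 : (0 : ℝ) < M.jac K t ^ 2 := by positivity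
    rw [this] at h3
    exact h3.ne')
  refine hg.congr_deriv ?_
  change _ / (2 * M.jac K t) = _
  rw [elemDiv_eq hM ht, div_eq_iff (by positivity)]
  rw [show ∀ y : ℝ, M.jac K t * ((M.jac K t ^ 2)⁻¹ * y) * (2 * M.jac K t) = 2 * y from
    fun y => by field_simp]
  rw [real_inner_comm (M.edge K t 1) (M.edgeVel K t 1),
    real_inner_comm (M.edge K t 2) (M.edgeVel K t 2),
    real_inner_comm (M.edge K t 1) (M.edgeVel K t 2)]
  push_cast
  ring

lemma hasDerivWithinAt_mass (hM : M.IsAdmissible ρ) (ht : t ∈ Icc 0 T) (i : Fin M.numNodes) :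
    HasDerivWithinAt (fun s => M.mass s i) (M.massDeriv t i) (Icc 0 T) t :=
  HasDerivWithinAt.fun_sum fun K _ => ((hasDerivWithinAt_jac hM ht K).div_const 6).mul_const _

lemma continuousOn_velocity_node (i : Fin M.numNodes) :
    ContinuousOn (fun t => S.velocity t (M.node i t)) (Icc 0 T) := by
  obtain ⟨V', -, hk⟩ := S.velocity_regular
  have h0 := (hk 0 (by norm_num)).1
  have h1 : ContinuousOn (fun q : ℝ × E3 => S.velocity q.1 q.2) (Icc 0 T ×ˢ univ) := by
    have := (continuous_eval_const (0 : Fin 0 → E3)).comp_continuousOn h0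
    exact this
  exact h1.comp (continuousOn_id.prodMk (continuousOn_node i)) fun t ht => ⟨ht, mem_univ _⟩

lemma continuousOn_massDeriv (hM : M.IsAdmissible ρ) (i : Fin M.numNodes) :
    ContinuousOn (fun t => M.massDeriv t i) (Icc 0 T) := by
  refine continuousOn_finsetSum _ fun K _ => ?_
  have hJ : ContinuousOn (M.jac K) (Icc 0 T) := fun t ht =>
    (hasDerivWithinAt_jac hM ht K).continuousWithinAt
  have he : ∀ j, ContinuousOn (fun t => M.edge K t j) (Icc 0 T) := fun j t ht =>
    (hasDerivWithinAt_edge ht K j).continuousWithinAt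
  have hv : ∀ j, ContinuousOn (fun t => M.edgeVel K t j) (Icc 0 T) := fun j =>
    (continuousOn_velocity_node _).sub (continuousOn_velocity_node _)
  have hd : ContinuousOn (M.elemDiv K) (Icc 0 T) := by
    refine ContinuousOn.congr (f := fun t => (M.jac K t ^ 2)⁻¹ * _) ?_
      fun t ht => elemDiv_eq hM ht K
    refine ((hJ.pow 2).inv₀ fun t ht => (pow_pos (jac_pos hM ht K) 2).ne').mul ?_
    exact (((((he 2).norm.pow 2).mul ((hv 1).inner (he 1))).sub
      (((he 1).inner (he 2)).mul ((hv 2).inner (he 1)))).add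
      (((he 1).norm.pow 2).mul ((hv 2).inner (he 2)))).sub
      (((he 1).inner (he 2)).mul ((hv 1).inner (he 2)))
  exact ((hJ.mul hd).div_const 6).mul_const _

variable (M) in
/-- The time derivative of `nodalRot`. -/
def nodalRotDeriv (K : Fin M.numTris) (t : ℝ) (η : Fin M.numNodes → ℝ) : E3 :=
  rotGrad (M.edgeVel K t 1) (M.edgeVel K t 2)
    (η (M.vert K 1) - η (M.vert K 0)) (η (M.vert K 2) - η (M.vert K 0))

variable (M) in
/-- The time derivative of the form `a_h` for fixed nodal values. -/
noncomputable def stiffFormDeriv (t : ℝ) (η ζ : Fin M.numNodes → ℝ) : ℝ :=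
  ∑ K, (2 * M.jac K t)⁻¹ * (inner ℝ (M.nodalRot K t η) (M.nodalRotDeriv K t ζ)
    + inner ℝ (M.nodalRotDeriv K t η) (M.nodalRot K t ζ)
    - M.elemDiv K t * inner ℝ (M.nodalRot K t η) (M.nodalRot K t ζ))

lemma hasDerivWithinAt_stiffForm (hM : M.IsAdmissible ρ) (ht : t ∈ Icc 0 T)
    (η ζ : Fin M.numNodes → ℝ) :
    HasDerivWithinAt (fun s => M.stiffForm s η ζ) (M.stiffFormDeriv t η ζ) (Icc 0 T) t := by
  refine HasDerivWithinAt.fun_sum fun K _ => ?_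
  have hJ := jac_pos hM ht K
  have hrot : ∀ η, HasDerivWithinAt (fun s => M.nodalRot K s η) (M.nodalRotDeriv K t η)
      (Icc 0 T) t := fun η =>
    ((hasDerivWithinAt_edge ht K 2).const_smul (η (M.vert K 1) - η (M.vert K 0))).sub
      ((hasDerivWithinAt_edge ht K 1).const_smul (η (M.vert K 2) - η (M.vert K 0)))
  have h := (((hasDerivWithinAt_jac hM ht K).const_mul 2).inv (by positivity)).mul
    ((hrot η).inner ℝ (hrot ζ))
  refine h.congr_deriv ?_
  simp only [Pi.inv_apply]
  field_simp
  ring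

/-! ### Shape regularity and the bound for the derivative of the Dirichlet form -/

lemma dist_vertex_le_meshSize (ht : t ∈ Icc 0 T) (K : Fin M.numTris) (i j : Fin 3) :
    ‖M.vertex K t i - M.vertex K t j‖ ≤ M.meshSize := by
  have hcpt : IsCompact ((fun q : ℝ × E3 => S.flow q.1 q.2) '' (Icc 0 T ×ˢ S.Γ₀)) :=
    (isCompact_Icc.prod S.isClosedC2Surface.isCompact).image_of_continuousOn S.flow_continuousOn
  have hbdd : BddAbove {d | ∃ t ∈ Icc 0 T, ∃ K, d = Metric.diam (M.elem K t)} := by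
    refine ⟨Metric.diam ((fun q : ℝ × E3 => S.flow q.1 q.2) '' (Icc 0 T ×ˢ S.Γ₀)), ?_⟩
    rintro d ⟨s, hs, L, rfl⟩
    rw [elem, convexHull_diam]
    refine Metric.diam_mono ?_ hcpt.isBounded
    rintro _ ⟨k, rfl⟩
    exact ⟨(s, _), ⟨hs, M.node₀_mem (M.vert L k)⟩, rfl⟩
  rw [← dist_eq_norm]
  exact (Metric.dist_le_diam_of_mem (isCompact_elem K t).isBounded
    (subset_convexHull ℝ _ (mem_range_self i)) (subset_convexHull ℝ _ (mem_range_self j))).trans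
    (le_csSup hbdd ⟨t, ht, K, rfl⟩)

/-- Shape regularity: the height over one edge is at least the inscribed diameter, hence at least
`ρ h`, and the other edge has length at most `h`. -/
lemma mul_norm_edge_le_jac (hM : M.IsAdmissible ρ) (hρ : 0 < ρ) (ht : t ∈ Icc 0 T)
    (K : Fin M.numTris) : ρ * (‖M.edge K t 1‖ * ‖M.edge K t 2‖) ≤ M.jac K t := by
  have h1 := inballDiam_mul_le (hM.nondegenerate t ht K)
  have h2 := hM.quasiUniform t ht K
  have h3 : ‖M.edge K t 2‖ ≤ M.meshSize := dist_vertex_le_meshSize ht K 2 0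
  calc ρ * (‖M.edge K t 1‖ * ‖M.edge K t 2‖)
      ≤ ρ * (‖M.edge K t 1‖ * M.meshSize) := by gcongr
    _ = (ρ * M.meshSize) * ‖M.edge K t 1‖ := by ring
    _ ≤ inballDiam (M.elem K t) * ‖M.edge K t 1‖ := by gcongr
    _ ≤ M.jac K t := h1

/-- The discrete divergence is bounded through the Lipschitz constant of the velocity and shape
regularity, independently of the mesh size. -/
lemma abs_elemDiv_le (hM : M.IsAdmissible ρ) (hρ : 0 < ρ) (ht : t ∈ Icc 0 T) {L : ℝ} (hL0 : 0 ≤ L)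
    (hL : ∀ x ∈ S.surf t, ∀ y ∈ S.surf t, ‖S.velocity t x - S.velocity t y‖ ≤ L * ‖x - y‖)
    (K : Fin M.numTris) : |M.elemDiv K t| ≤ 4 * L / ρ ^ 2 := by
  have hJ := jac_pos hM ht K
  have hv : ∀ j, ‖M.edgeVel K t j‖ ≤ L * ‖M.edge K t j‖ := fun j =>
    hL _ (node_mem _ t) _ (node_mem _ t)
  have hi : ∀ i j, |inner ℝ (M.edgeVel K t i) (M.edge K t j)| ≤
      L * ‖M.edge K t i‖ * ‖M.edge K t j‖ := fun i j =>
    (abs_real_inner_le_norm _ _).trans (mul_le_mul_of_nonneg_right (hv i) (norm_nonneg _))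
  have he := abs_real_inner_le_norm (M.edge K t 1) (M.edge K t 2)
  have hP := mul_norm_edge_le_jac hM hρ ht K
  have hP2 : ρ ^ 2 * (‖M.edge K t 1‖ * ‖M.edge K t 2‖) ^ 2 ≤ M.jac K t ^ 2 := by
    rw [← mul_pow]; gcongr
  rw [elemDiv_eq hM ht, abs_mul, abs_of_nonneg (by positivity), inv_mul_le_iff₀ (by positivity)]
  have b1 : |‖M.edge K t 2‖ ^ 2 * inner ℝ (M.edgeVel K t 1) (M.edge K t 1)| ≤
      L * (‖M.edge K t 1‖ * ‖M.edge K t 2‖) ^ 2 := by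
    rw [abs_mul, abs_of_nonneg (by positivity)]
    refine (mul_le_mul_of_nonneg_left (hi 1 1) (by positivity)).trans_eq (by ring)
  have b2 : |inner ℝ (M.edge K t 1) (M.edge K t 2) * inner ℝ (M.edgeVel K t 2) (M.edge K t 1)| ≤
      L * (‖M.edge K t 1‖ * ‖M.edge K t 2‖) ^ 2 := by
    rw [abs_mul]
    refine (mul_le_mul he (hi 2 1) (abs_nonneg _) (by positivity)).trans_eq (by ring)
  have b3 : |‖M.edge K t 1‖ ^ 2 * inner ℝ (M.edgeVel K t 2) (M.edge K t 2)| ≤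
      L * (‖M.edge K t 1‖ * ‖M.edge K t 2‖) ^ 2 := by
    rw [abs_mul, abs_of_nonneg (by positivity)]
    refine (mul_le_mul_of_nonneg_left (hi 2 2) (by positivity)).trans_eq (by ring)
  have b4 : |inner ℝ (M.edge K t 1) (M.edge K t 2) * inner ℝ (M.edgeVel K t 1) (M.edge K t 2)| ≤
      L * (‖M.edge K t 1‖ * ‖M.edge K t 2‖) ^ 2 := by
    rw [abs_mul]
    refine (mul_le_mul he (hi 1 2) (abs_nonneg _) (by positivity)).trans_eq (by ring)
  have hfin : 4 * (L * (‖M.edge K t 1‖ * ‖M.edge K t 2‖) ^ 2) ≤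
      M.jac K t ^ 2 * (4 * L / ρ ^ 2) := by
    rw [mul_div_assoc', le_div_iff₀ (by positivity)]
    nlinarith [mul_le_mul_of_nonneg_left hP2 hL0]
  rw [abs_le] at *
  constructor <;> linarith [b1.1, b1.2, b2.1, b2.2, b3.1, b3.2, b4.1, b4.2]

/-- Moving the edges changes `p e₂ - q e₁` by at most `L (|p| |e₂| + |q| |e₁|)`, and in a shape
regular triangle there is no cancellation between the two summands of `p e₂ - q e₁`. -/
lemma norm_nodalRotDeriv_le (hM : M.IsAdmissible ρ) (hρ : 0 < ρ) (ht : t ∈ Icc 0 T) {L : ℝ}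
    (hL0 : 0 ≤ L)
    (hL : ∀ x ∈ S.surf t, ∀ y ∈ S.surf t, ‖S.velocity t x - S.velocity t y‖ ≤ L * ‖x - y‖)
    (K : Fin M.numTris) (η : Fin M.numNodes → ℝ) :
    ‖M.nodalRotDeriv K t η‖ ≤ 2 * L / ρ * ‖M.nodalRot K t η‖ := by
  have hJ := jac_pos hM ht K
  have hv : ∀ j, ‖M.edgeVel K t j‖ ≤ L * ‖M.edge K t j‖ := fun j =>
    hL _ (node_mem _ t) _ (node_mem _ t)
  have hP := mul_norm_edge_le_jac hM hρ ht K
  have hb := triJac_mul_le_norm_rotGrad (M.vertex K t 0) (M.vertex K t 1) (M.vertex K t 2)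
    (η (M.vert K 1) - η (M.vert K 0)) (η (M.vert K 2) - η (M.vert K 0))
  change M.jac K t * _ ≤ ‖M.edge K t 1‖ * ‖M.nodalRot K t η‖ ∧
    M.jac K t * _ ≤ ‖M.edge K t 2‖ * ‖M.nodalRot K t η‖ at hb
  rw [nodalRotDeriv]
  generalize η (M.vert K 1) - η (M.vert K 0) = p at *
  generalize η (M.vert K 2) - η (M.vert K 0) = q at *
  generalize ‖M.nodalRot K t η‖ = X at *
  have hpos : ∀ j, j ≠ 0 → 0 < ‖M.edge K t j‖ := fun j hj => norm_pos_iff.2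
    (sub_ne_zero.2 ((hM.nondegenerate t ht K).injective.ne hj))
  have h1 := hpos 1 (by decide)
  have h2 := hpos 2 (by decide)
  have hp : ρ * (|p| * ‖M.edge K t 2‖) ≤ X := by
    refine le_of_mul_le_mul_left ?_ h1
    nlinarith [mul_le_mul_of_nonneg_right hP (abs_nonneg p)]
  have hq : ρ * (|q| * ‖M.edge K t 1‖) ≤ X := by
    refine le_of_mul_le_mul_left ?_ h2
    nlinarith [mul_le_mul_of_nonneg_right hP (abs_nonneg q)]
  calc ‖rotGrad (M.edgeVel K t 1) (M.edgeVel K t 2) p q‖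
      ≤ |p| * ‖M.edgeVel K t 2‖ + |q| * ‖M.edgeVel K t 1‖ := by
        refine (norm_sub_le _ _).trans_eq ?_
        rw [norm_smul, norm_smul, Real.norm_eq_abs, Real.norm_eq_abs]
    _ ≤ |p| * (L * ‖M.edge K t 2‖) + |q| * (L * ‖M.edge K t 1‖) := by
        gcongr <;> exact hv _
    _ = L * ((|p| * ‖M.edge K t 2‖) + (|q| * ‖M.edge K t 1‖)) := by ring
    _ ≤ L * (X / ρ + X / ρ) := by
        gcongr <;> rw [le_div_iff₀ hρ] <;> linarith
    _ = 2 * L / ρ * X := by ring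

lemma abs_stiffFormDeriv_le (hM : M.IsAdmissible ρ) (hρ : 0 < ρ) (ht : t ∈ Icc 0 T) {L : ℝ}
    (hL0 : 0 ≤ L)
    (hL : ∀ x ∈ S.surf t, ∀ y ∈ S.surf t, ‖S.velocity t x - S.velocity t y‖ ≤ L * ‖x - y‖)
    (η : Fin M.numNodes → ℝ) :
    |M.stiffFormDeriv t η η| ≤ (4 * L / ρ + 4 * L / ρ ^ 2) * M.stiffForm t η η := by
  rw [stiffFormDeriv, stiffForm, Finset.mul_sum]
  refine (Finset.abs_sum_le_sum_abs _ _).trans (Finset.sum_le_sum fun K _ => ?_)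
  have hJ := jac_pos hM ht K
  have h1 := norm_nodalRotDeriv_le hM hρ ht hL0 hL K η
  have h2 := abs_elemDiv_le hM hρ ht hL0 hL K
  have h3 := abs_real_inner_le_norm (M.nodalRot K t η) (M.nodalRotDeriv K t η)
  have h4 : |inner ℝ (M.nodalRot K t η) (M.nodalRotDeriv K t η)| ≤
      2 * L / ρ * ‖M.nodalRot K t η‖ ^ 2 :=
    h3.trans ((mul_le_mul_of_nonneg_left h1 (norm_nonneg _)).trans_eq (by ring))
  have h5 : |M.elemDiv K t * ‖M.nodalRot K t η‖ ^ 2| ≤ 4 * L / ρ ^ 2 * ‖M.nodalRot K t η‖ ^ 2 := by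
    rw [abs_mul, abs_of_nonneg (sq_nonneg ‖M.nodalRot K t η‖)]
    gcongr
  rw [abs_mul, abs_of_nonneg (by positivity), real_inner_comm (M.nodalRot K t η),
    real_inner_self_eq_norm_sq, mul_left_comm]
  refine mul_le_mul_of_nonneg_left ?_ (by positivity)
  have h6 : 4 * L / ρ = 2 * (2 * L / ρ) := by ring
  rw [h6]
  rw [abs_le] at *
  constructor <;> linarith [h4.1, h4.2, h5.1, h5.2]

end EvolvingMesh

/-! ### Time-dependent linear systems and Grönwall's inequality -/

section LinearSystems

variable {ι : Type*} [Fintype ι]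

lemma dotProduct_mulVec_comm_of_isSymm {A : Matrix ι ι ℝ} (hA : A.IsSymm) (v w : ι → ℝ) :
    v ⬝ᵥ A.mulVec w = w ⬝ᵥ A.mulVec v := by
  rw [Matrix.dotProduct_mulVec, ← Matrix.mulVec_transpose, hA.eq, dotProduct_comm]

/-- The derivative of the energy `x · A x` of the solution of `A x = z`, in terms of the
derivatives of `A` and `z` alone. -/
lemma hasDerivWithinAt_energy {A : ℝ → Matrix ι ι ℝ} {A' : Matrix ι ι ℝ} {z x : ℝ → ι → ℝ}
    {z' : ι → ℝ} {s : Set ℝ} {t : ℝ} (hs : UniqueDiffWithinAt ℝ s t) (hts : t ∈ s)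
    (hsymm : (A t).IsSymm)
    (hA : ∀ i j, HasDerivWithinAt (fun r => A r i j) (A' i j) s t)
    (hz : ∀ i, HasDerivWithinAt (fun r => z r i) (z' i) s t)
    (hx : ∀ i, DifferentiableWithinAt ℝ (fun r => x r i) s t)
    (hsol : ∀ r ∈ s, (A r).mulVec (x r) = z r) :
    HasDerivWithinAt (fun r => x r ⬝ᵥ z r) (2 * (x t ⬝ᵥ z') - x t ⬝ᵥ A'.mulVec (x t)) s t := by
  set x' : ι → ℝ := fun i => derivWithin (fun r => x r i) s t
  have hx' : ∀ i, HasDerivWithinAt (fun r => x r i) (x' i) s t := fun i =>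
    (hx i).hasDerivWithinAt
  have hz' : z' = A'.mulVec (x t) + (A t).mulVec x' := by
    funext i
    have h1 : HasDerivWithinAt (fun r => ((A r).mulVec (x r)) i)
        (∑ j, (A' i j * x t j + A t i j * x' j)) s t :=
      HasDerivWithinAt.fun_sum fun j _ => (hA i j).mul (hx' j)
    have h2 : HasDerivWithinAt (fun r => z r i) _ s t :=
      h1.congr_of_mem (fun r hr => by rw [← hsol r hr]) hts
    rw [hs.eq_deriv _ (hz i) h2, Finset.sum_add_distrib]
    rfl
  have hE : HasDerivWithinAt (fun r => x r ⬝ᵥ z r) (∑ i, (x' i * z t i + x t i * z' i)) s t :=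
    HasDerivWithinAt.fun_sum fun i _ => (hx' i).mul (hz i)
  refine hE.congr_deriv ?_
  have h3 : ∑ i, (x' i * z t i + x t i * z' i) = x' ⬝ᵥ z t + x t ⬝ᵥ z' := Finset.sum_add_distrib
  have h4 : x' ⬝ᵥ z t = x t ⬝ᵥ (A t).mulVec x' := by
    rw [← hsol t hts, dotProduct_mulVec_comm_of_isSymm hsymm]
  have h5 : x t ⬝ᵥ z' = x t ⬝ᵥ A'.mulVec (x t) + x t ⬝ᵥ (A t).mulVec x' := by
    rw [hz', dotProduct_add]
  rw [h3, h4]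
  linarith

/-- Young's inequality for a positive semidefinite form. -/
lemma two_mul_dotProduct_mulVec_le {A : Matrix ι ι ℝ} (hA : A.IsSymm)
    (hnn : ∀ v, 0 ≤ v ⬝ᵥ A.mulVec v) (v w : ι → ℝ) {δ : ℝ} (hδ : 0 < δ) :
    2 * (v ⬝ᵥ A.mulVec w) ≤ δ * (v ⬝ᵥ A.mulVec v) + δ⁻¹ * (w ⬝ᵥ A.mulVec w) := by
  have h := hnn (δ • v - w)
  simp only [Matrix.mulVec_sub, Matrix.mulVec_smul, dotProduct_sub, sub_dotProduct,
    smul_dotProduct, dotProduct_smul, smul_eq_mul] at h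
  rw [dotProduct_mulVec_comm_of_isSymm hA w v] at h
  have h2 : δ * (v ⬝ᵥ A.mulVec v) + δ⁻¹ * (w ⬝ᵥ A.mulVec w) - 2 * (v ⬝ᵥ A.mulVec w) =
    δ⁻¹ * (δ * (δ * (v ⬝ᵥ A.mulVec v)) - δ * (v ⬝ᵥ A.mulVec w) -
      (δ * (v ⬝ᵥ A.mulVec w) - w ⬝ᵥ A.mulVec w)) := by field_simp; ring
  have h3 : 0 ≤ δ⁻¹ := by positivity
  nlinarith [mul_nonneg h3 h]

variable [DecidableEq ι]

/-- `x` is the solution of `A x = z` with `m · x = 0`, by Cramer's rule for the regularized matrix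
`A + m mᵀ`. -/
noncomputable def meanFreeSolution (A : Matrix ι ι ℝ) (m z : ι → ℝ) (i : ι) : ℝ :=
  ((A + Matrix.vecMulVec m m).updateCol i z).det / (A + Matrix.vecMulVec m m).det

/-- If the kernel of the positive semidefinite matrix `A` consists of the constants, then
`A + m mᵀ` is definite. Pairing `(A + m mᵀ) x = z` with the constant vector shows `m · x = 0` as
soon as `z` has sum zero. -/
lemma meanFreeSolution_spec {A : Matrix ι ι ℝ} (hA : A.IsSymm)
    (hnn : ∀ v, 0 ≤ v ⬝ᵥ A.mulVec v) (h1 : A.mulVec 1 = 0)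
    (hker : ∀ v, v ⬝ᵥ A.mulVec v = 0 → ∀ i j, v i = v j) {m : ι → ℝ} (hm : ∀ i, 0 < m i) :
    (A + Matrix.vecMulVec m m).det ≠ 0 ∧ ∀ z : ι → ℝ, ∑ i, z i = 0 →
      A.mulVec (meanFreeSolution A m z) = z ∧ m ⬝ᵥ meanFreeSolution A m z = 0 := by
  have hB : ∀ v, (A + Matrix.vecMulVec m m).mulVec v = A.mulVec v + (m ⬝ᵥ v) • m := fun v => by
    rw [Matrix.add_mulVec, Matrix.vecMulVec_mulVec, op_smul_eq_smul]
  have hdet : (A + Matrix.vecMulVec m m).det ≠ 0 := by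
    intro h0
    obtain ⟨v, hv, hv0⟩ := Matrix.exists_mulVec_eq_zero_iff.2 h0
    rw [hB] at hv0
    have h2 : v ⬝ᵥ A.mulVec v + (m ⬝ᵥ v) ^ 2 = 0 := by
      have := congrArg (v ⬝ᵥ ·) hv0
      simp only [dotProduct_add, dotProduct_smul, dotProduct_zero, smul_eq_mul] at this
      rw [dotProduct_comm v m] at this
      rw [sq]; exact this
    have h3 : m ⬝ᵥ v = 0 := by
      have := hnn v
      nlinarith [sq_nonneg (m ⬝ᵥ v)]
    have h4 := hker v (by rw [h3] at h2; linarith)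
    refine hv (funext fun i => ?_)
    have h5 : m ⬝ᵥ v = (∑ j, m j) * v i := by
      rw [dotProduct, Finset.sum_mul]
      exact Finset.sum_congr rfl fun j _ => by rw [h4 j i]
    rw [h3] at h5
    exact (mul_eq_zero.1 h5.symm).resolve_left
      (Finset.sum_pos (fun j _ => hm j) ⟨i, Finset.mem_univ i⟩).ne'
  refine ⟨hdet, fun z hz => ?_⟩
  have hsol : (A + Matrix.vecMulVec m m).mulVec (meanFreeSolution A m z) = z := by
    have hx : meanFreeSolution A m z =
        ((A + Matrix.vecMulVec m m).det)⁻¹ • (A + Matrix.vecMulVec m m).cramer z := by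
      funext i
      rw [Pi.smul_apply, Matrix.cramer_apply, meanFreeSolution, smul_eq_mul, div_eq_inv_mul]
    rw [hx, Matrix.mulVec_smul, Matrix.mulVec_cramer, smul_smul, inv_mul_cancel₀ hdet, one_smul]
  rw [hB] at hsol
  have h6 : (m ⬝ᵥ meanFreeSolution A m z) * ∑ i, m i = 0 := by
    have h7 := congrArg ((1 : ι → ℝ) ⬝ᵥ ·) hsol
    simp only [dotProduct_add, dotProduct_smul, smul_eq_mul] at h7
    rw [dotProduct_mulVec_comm_of_isSymm hA, h1, dotProduct_zero, zero_add, one_dotProduct,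
      one_dotProduct, hz] at h7
    exact h7
  have h8 : m ⬝ᵥ meanFreeSolution A m z = 0 := by
    rcases isEmpty_or_nonempty ι with hι | hι
    · simp [dotProduct]
    · exact (mul_eq_zero.1 h6).resolve_right
        (Finset.sum_pos (fun j _ => hm j) Finset.univ_nonempty).ne'
  rw [h8, zero_smul, add_zero] at hsol
  exact ⟨hsol, h8⟩

lemma DifferentiableWithinAt.matrix_det {A : ℝ → Matrix ι ι ℝ} {s : Set ℝ} {t : ℝ}
    (hA : ∀ i j, DifferentiableWithinAt ℝ (fun r => A r i j) s t) :
    DifferentiableWithinAt ℝ (fun r => (A r).det) s t := by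
  simp only [Matrix.det_apply]
  refine DifferentiableWithinAt.fun_sum fun σ _ => DifferentiableWithinAt.const_smul ?_ _
  exact DifferentiableWithinAt.fun_finsetProd fun i _ => hA _ _

lemma differentiableWithinAt_meanFreeSolution {A : ℝ → Matrix ι ι ℝ} {m z : ℝ → ι → ℝ} {s : Set ℝ}
    {t : ℝ} (hA : ∀ i j, DifferentiableWithinAt ℝ (fun r => A r i j) s t)
    (hm : ∀ i, DifferentiableWithinAt ℝ (fun r => m r i) s t)
    (hz : ∀ i, DifferentiableWithinAt ℝ (fun r => z r i) s t)
    (hdet : (A t + Matrix.vecMulVec (m t) (m t)).det ≠ 0) (i : ι) :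
    DifferentiableWithinAt ℝ (fun r => meanFreeSolution (A r) (m r) (z r) i) s t := by
  have hB : ∀ i j, DifferentiableWithinAt ℝ
      (fun r => (A r + Matrix.vecMulVec (m r) (m r)) i j) s t := fun i j =>
    (hA i j).add ((hm i).mul (hm j))
  refine DifferentiableWithinAt.div (DifferentiableWithinAt.matrix_det fun j k => ?_)
    (DifferentiableWithinAt.matrix_det hB) hdet
  simp only [Matrix.updateCol_apply]
  split_ifs
  exacts [hz j, hB j k]

end LinearSystems

/-- Grönwall's inequality with a dissipation term. -/
lemma gronwall_with_dissipation {T ε C : ℝ} (hε : 0 ≤ ε) (hC : 0 ≤ C) {E E' D : ℝ → ℝ}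
    (hD : ContinuousOn D (Icc 0 T)) (hD0 : ∀ t ∈ Icc 0 T, 0 ≤ D t)
    (hE : ∀ t ∈ Icc 0 T, HasDerivWithinAt E (E' t) (Icc 0 T) t)
    (hE' : ∀ t ∈ Icc 0 T, E' t + ε * D t ≤ C * E t) {t : ℝ} (ht : t ∈ Icc 0 T) :
    E t + ε * ∫ s in (0 : ℝ)..t, D s ≤ Real.exp (C * t) * E 0 := by
  have hT : 0 ≤ T := ht.1.trans ht.2
  have hDi : ∀ r ∈ Icc 0 T, IntervalIntegrable D volume 0 r := fun r hr =>
    (hD.mono (by rw [uIcc_of_le hr.1]; exact Icc_subset_Icc_right hr.2)).intervalIntegrable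
  set P : ℝ → ℝ := fun r => E r + ε * ∫ s in (0 : ℝ)..r, D s with hP
  have hPc : ContinuousOn P (Icc 0 T) := by
    refine ContinuousOn.add (fun r hr => (hE r hr).continuousWithinAt)
      (continuousOn_const.mul ?_)
    have := intervalIntegral.continuousOn_primitive_interval (μ := volume) (f := D)
      (a := 0) (b := T)
      (by rw [uIcc_of_le hT]; exact hD.integrableOn_Icc)
    rwa [uIcc_of_le hT] at this
  have hPd : ∀ r ∈ Ioo 0 T, HasDerivAt P (E' r + ε * D r) r := by
    intro r hr
    have hr' := Ioo_subset_Icc_self hr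
    have hnhds : Icc 0 T ∈ nhds r := Icc_mem_nhds hr.1 hr.2
    refine ((hE r hr').hasDerivAt hnhds).add (HasDerivAt.const_mul ε ?_)
    refine intervalIntegral.integral_hasDerivAt_right (hDi r hr') ?_
      (hD.continuousAt hnhds)
    exact ⟨Icc 0 T, hnhds, hD.aestronglyMeasurable measurableSet_Icc⟩
  have hanti : AntitoneOn (fun r => Real.exp (-(C * r)) * P r) (Icc 0 T) := by
    have hd : ∀ r ∈ Ioo 0 T, HasDerivAt (fun r => Real.exp (-(C * r)) * P r)
        (Real.exp (-(C * r)) * (-(C * 1)) * P r + Real.exp (-(C * r)) * (E' r + ε * D r)) r :=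
      fun r hr => (((hasDerivAt_id r).const_mul C).neg.exp).mul (hPd r hr)
    refine antitoneOn_of_deriv_nonpos (convex_Icc 0 T) ?_ ?_ ?_
    · exact (by fun_prop : Continuous fun r : ℝ => Real.exp (-(C * r))).continuousOn.mul hPc
    · rw [interior_Icc]
      exact fun r hr => (hd r hr).differentiableAt.differentiableWithinAt
    · rw [interior_Icc]
      intro r hr
      rw [(hd r hr).deriv]
      have h1 := hE' r (Ioo_subset_Icc_self hr)
      have h2 : 0 ≤ ∫ s in (0 : ℝ)..r, D s := intervalIntegral.integral_nonneg hr.1.le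
        fun s hs => hD0 s ⟨hs.1, hs.2.trans hr.2.le⟩
      have h3 : E' r + ε * D r ≤ C * P r := by
        have : 0 ≤ C * (ε * ∫ s in (0 : ℝ)..r, D s) := by positivity
        simp only [hP, mul_add]
        linarith
      nlinarith [mul_le_mul_of_nonneg_left h3 (Real.exp_pos (-(C * r))).le]
  have h := hanti ⟨le_rfl, hT⟩ ht ht.1
  simp only [hP, mul_zero, neg_zero, Real.exp_zero, one_mul, intervalIntegral.integral_same,
    add_zero, Real.exp_neg] at h
  rwa [inv_mul_le_iff₀ (Real.exp_pos _)] at h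

/-- An inequality between continuous functions that holds almost everywhere on an interval holds
everywhere. -/
lemma le_on_Icc_of_ae_le {T : ℝ} (hT : 0 < T) {f g : ℝ → ℝ} (hf : ContinuousOn f (Icc 0 T))
    (hg : ContinuousOn g (Icc 0 T)) (h : ∀ᵐ t ∂(volume.restrict (Icc 0 T)), f t ≤ g t) :
    ∀ t ∈ Icc 0 T, f t ≤ g t := fun t ht => by
  have := Measure.eqOn_Icc_of_ae_eq (μ := volume) hT.ne (f := fun t => max (f t) (g t)) (g := g)
    (h.mono fun t ht => max_eq_right ht) (hf.sup hg) hg ht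
  exact max_eq_right_iff.1 this

/-! ### Connectedness of the triangulated surface and the kernel of the Dirichlet form -/

lemma normalProj_spec {Γ : Set E3} {x : E3}
    (h : ∃ p, p ∈ Γ ∧ dist x p = Metric.infDist x Γ) :
    normalProj Γ x ∈ Γ ∧ dist x (normalProj Γ x) = Metric.infDist x Γ := by
  rw [normalProj, dif_pos h]
  exact h.choose_spec

/-- A compact set that is mapped bijectively onto a connected compact surface by the nearest point
projection is connected: the projection maps relatively closed sets to closed sets. -/
lemma isPreconnected_of_bijOn_normalProj {Γ X : Set E3} (hΓ : IsCompact Γ)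
    (hΓc : IsPreconnected Γ) (hX : IsCompact X)
    (huniq : ∀ x ∈ X, ∃! p, p ∈ Γ ∧ dist x p = Metric.infDist x Γ)
    (hbij : BijOn (normalProj Γ) X Γ) : IsPreconnected X := by
  have hclosed : ∀ F : Set E3, IsClosed F → IsClosed (normalProj Γ '' (X ∩ F)) := by
    intro F hF
    have heq : normalProj Γ '' (X ∩ F) = Prod.snd ''
        (((X ∩ F) ×ˢ Γ) ∩ {q : E3 × E3 | dist q.1 q.2 = Metric.infDist q.1 Γ}) := by
      ext p
      constructor
      · rintro ⟨x, hx, rfl⟩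
        obtain ⟨h1, h2⟩ := normalProj_spec (huniq x hx.1).exists
        exact ⟨(x, normalProj Γ x), ⟨⟨hx, h1⟩, h2⟩, rfl⟩
      · rintro ⟨⟨x, q⟩, ⟨⟨hx, hq⟩, hd⟩, rfl⟩
        exact ⟨x, hx, (huniq x hx.1).unique (normalProj_spec (huniq x hx.1).exists) ⟨hq, hd⟩⟩
    rw [heq]
    refine IsCompact.isClosed (IsCompact.image ?_ continuous_snd)
    exact ((hX.inter_right hF).prod hΓ).inter_right (isClosed_eq (by fun_prop)
      ((Metric.continuous_infDist_pt Γ).comp continuous_fst))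
  rw [isPreconnected_closed_iff] at hΓc ⊢
  intro F G hF hG hFG hXF hXG
  obtain ⟨p, -, ⟨x, hx, hxp⟩, ⟨y, hy, hyp⟩⟩ := hΓc _ _ (hclosed F hF) (hclosed G hG)
    (by
      rw [← image_union, ← inter_union_distrib_left, inter_eq_left.2 hFG, hbij.image_eq])
    (by
      obtain ⟨x, hx⟩ := hXF
      exact ⟨_, hbij.mapsTo hx.1, x, hx, rfl⟩)
    (by
      obtain ⟨x, hx⟩ := hXG
      exact ⟨_, hbij.mapsTo hx.1, x, hx, rfl⟩)
  have := hbij.injOn hx.1 hy.1 (hxp.trans hyp.symm)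
  subst this
  exact ⟨x, hx.1, hx.2, hy.2⟩

namespace EvolvingMesh

variable {T : ℝ} {S : EvolvingSurface T} {M : EvolvingMesh S} {ρ t : ℝ}

lemma isPreconnected_surf (hM : M.IsAdmissible ρ) (ht : t ∈ Icc 0 T) :
    IsPreconnected (M.surf t) := by
  obtain ⟨r, hr, hdist, hbij⟩ := hM.exact_lift t ht
  have hflow : ContinuousOn (S.flow t) S.Γ₀ :=
    S.flow_continuousOn.comp (continuousOn_const.prodMk continuousOn_id) fun x hx => ⟨ht, hx⟩
  exact isPreconnected_of_bijOn_normalProj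
    (S.isClosedC2Surface.isCompact.image_of_continuousOn hflow)
    (S.isClosedC2Surface.isConnected.isPreconnected.image _ hflow) (isCompact_surf t)
    (fun x hx => hr.2 x (hdist x hx)) hbij

/-- On a connected triangulated surface only constants have vanishing tangential gradient. -/
lemma const_of_stiffForm_self_eq_zero (hM : M.IsAdmissible ρ) (ht : t ∈ Icc 0 T)
    {η : Fin M.numNodes → ℝ} (h : M.stiffForm t η η = 0) (i j : Fin M.numNodes) : η i = η j := by
  have hfin : (M.nodal t η '' M.surf t).Finite := by
    refine (finite_range η).subset ?_
    rintro _ ⟨x, hx, rfl⟩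
    obtain ⟨K, hK⟩ := mem_iUnion.1 hx
    obtain ⟨w, h0, h1, hw, rfl⟩ := isBary_of_mem hK
    refine ⟨M.vert K 0, ?_⟩
    rw [nodal_eq hM ht η ⟨K, h0, h1, hw, rfl⟩, ← mul_one (η _), ← h1, Finset.mul_sum]
    refine Finset.sum_congr rfl fun k _ => ?_
    by_cases hk : k ∈ range (M.vert K)
    · obtain ⟨l, rfl⟩ := hk
      rw [eq_of_stiffForm_self_eq_zero hM ht h K l]
    · simp [hw k hk]
  have hsub := hfin.countable.isTotallyDisconnected _ Subset.rfl
    ((isPreconnected_surf hM ht).image _ (nodal_mem_shape hM ht η).1)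
  have := hsub (mem_image_of_mem _ (node_mem_surf i t)) (mem_image_of_mem _ (node_mem_surf j t))
  rwa [nodal_node hM ht, nodal_node hM ht] at this

lemma isSymm_stiffMatrix (t : ℝ) : (M.stiffMatrix t).IsSymm :=
  Matrix.IsSymm.ext fun _ _ => stiffForm_comm t _ _

lemma stiffMatrix_nonneg (t : ℝ) (v : Fin M.numNodes → ℝ) :
    0 ≤ v ⬝ᵥ (M.stiffMatrix t).mulVec v := by
  rw [dotProduct_stiffMatrix]
  exact stiffForm_self_nonneg t v

lemma stiffMatrix_mulVec_apply (t : ℝ) (v : Fin M.numNodes → ℝ) (i : Fin M.numNodes) :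
    (M.stiffMatrix t).mulVec v i = M.stiffForm t (Pi.single i 1) v := by
  rw [← dotProduct_stiffMatrix, single_one_dotProduct]

lemma stiffMatrix_mulVec_one (t : ℝ) : (M.stiffMatrix t).mulVec 1 = 0 := by
  funext i
  rw [stiffMatrix_mulVec_apply]
  exact Finset.sum_eq_zero fun K _ => by simp [nodalRot, rotGrad]

lemma hasDerivWithinAt_stiffMatrix (hM : M.IsAdmissible ρ) (ht : t ∈ Icc 0 T)
    (i j : Fin M.numNodes) :
    HasDerivWithinAt (fun s => M.stiffMatrix s i j)
      (M.stiffFormDeriv t (Pi.single i 1) (Pi.single j 1)) (Icc 0 T) t :=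
  hasDerivWithinAt_stiffForm hM ht _ _

/-! ### The mass-lumped inverse Laplacian -/

variable (M) in
/-- The nodal values of `z`, weighted by the lumped masses: the load vector of
`φ ↦ ∫ I_h(z φ)`. -/
noncomputable def load (t : ℝ) (z : E3 → ℝ) (i : Fin M.numNodes) : ℝ :=
  M.mass t i * z (M.node i t)

lemma lumped_nodal_single (hM : M.IsAdmissible ρ) (ht : t ∈ Icc 0 T) (z : E3 → ℝ)
    (i : Fin M.numNodes) : M.lumped t z (M.nodal t (Pi.single i 1)) = M.load t z i := by
  rw [lumped_eq hM ht]
  simp [nodal_node hM ht, Pi.single_apply, load]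

lemma aForm_nodal_single (hM : M.IsAdmissible ρ) (ht : t ∈ Icc 0 T) (g : E3 → ℝ)
    (i : Fin M.numNodes) : M.aForm t g (M.nodal t (Pi.single i 1)) =
      (M.stiffMatrix t).mulVec (fun j => g (M.node j t)) i := by
  rw [aForm_eq hM ht, stiffMatrix_mulVec_apply, stiffForm_comm]
  simp only [nodal_node hM ht]

lemma lumped_eq_dotProduct (hM : M.IsAdmissible ρ) (ht : t ∈ Icc 0 T) (z φ : E3 → ℝ) :
    M.lumped t z φ = (fun i => φ (M.node i t)) ⬝ᵥ M.load t z := by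
  rw [lumped_eq hM ht]
  exact Finset.sum_congr rfl fun i _ => by rw [load]; ring

lemma meanFreeSolution_stiffMatrix (hM : M.IsAdmissible ρ) (ht : t ∈ Icc 0 T) :
    (M.stiffMatrix t + Matrix.vecMulVec (M.mass t) (M.mass t)).det ≠ 0 ∧
      ∀ z : Fin M.numNodes → ℝ, ∑ i, z i = 0 →
        (M.stiffMatrix t).mulVec (meanFreeSolution (M.stiffMatrix t) (M.mass t) z) = z ∧
          M.mass t ⬝ᵥ meanFreeSolution (M.stiffMatrix t) (M.mass t) z = 0 :=
  meanFreeSolution_spec (isSymm_stiffMatrix t) (stiffMatrix_nonneg t) (stiffMatrix_mulVec_one t)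
    (fun v hv => const_of_stiffForm_self_eq_zero hM ht (by rwa [dotProduct_stiffMatrix] at hv))
    (mass_pos hM ht)

/-- Solving the nodal system gives a mass-lumped inverse Laplacian. -/
lemma isLumpedInvLap_nodal (hM : M.IsAdmissible ρ) (ht : t ∈ Icc 0 T) {z : E3 → ℝ}
    (hz : ∑ i, M.load t z i = 0) :
    M.IsLumpedInvLap t z
      (M.nodal t (meanFreeSolution (M.stiffMatrix t) (M.mass t) (M.load t z))) := by
  obtain ⟨h1, h2⟩ := (meanFreeSolution_stiffMatrix hM ht).2 _ hz
  refine ⟨nodal_mem_shape hM ht _, ?_, fun φ _ => ?_⟩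
  · rw [integral_shape hM ht (nodal_mem_shape hM ht _)]
    simp only [nodal_node hM ht]
    exact h2
  · rw [aForm_eq hM ht, lumped_eq_dotProduct hM ht, stiffForm_comm, ← dotProduct_stiffMatrix]
    simp only [nodal_node hM ht]
    rw [h1]

/-- The inverse Laplacian exists for mean free data, and its norm is computed from the nodal
values. -/
lemma invNorm_sq (hM : M.IsAdmissible ρ) (ht : t ∈ Icc 0 T) {z : E3 → ℝ}
    (hz : ∑ i, M.load t z i = 0) :
    M.IsLumpedInvLap t z (M.lumpedInvLap t z) ∧ M.invNorm t z ^ 2 =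
      meanFreeSolution (M.stiffMatrix t) (M.mass t) (M.load t z) ⬝ᵥ M.load t z := by
  set g := M.nodal t (meanFreeSolution (M.stiffMatrix t) (M.mass t) (M.load t z)) with hg
  have hg1 : M.IsLumpedInvLap t z g := isLumpedInvLap_nodal hM ht hz
  have hg2 : M.IsLumpedInvLap t z (M.lumpedInvLap t z) := by
    have h : ∃ g, M.IsLumpedInvLap t z g := ⟨g, hg1⟩
    rw [lumpedInvLap, dif_pos h]
    exact h.choose_spec
  refine ⟨hg2, ?_⟩
  rw [invNorm, Real.sq_sqrt]
  · -- both inverse Laplacians have the same energy, by the symmetry of `a_h`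
    have h1 := hg2.2.2 _ hg2.1
    have h2 := hg2.2.2 _ hg1.1
    have h3 := hg1.2.2 _ hg2.1
    have hsymm : M.aForm t (M.lumpedInvLap t z) g = M.aForm t g (M.lumpedInvLap t z) := by
      rw [aForm_eq hM ht, aForm_eq hM ht, stiffForm_comm]
    rw [h1, ← h3, ← hsymm, h2, lumped_eq_dotProduct hM ht]
    simp only [hg, nodal_node hM ht]
  · rw [aForm_eq hM ht]
    exact stiffForm_self_nonneg t _

lemma sum_load_eq_of_mean_eq (hM : M.IsAdmissible ρ) (ht : t ∈ Icc 0 T) {η ζ : E3 → ℝ}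
    (hη : η ∈ M.shape t) (hζ : ζ ∈ M.shape t) (h : M.mean t η = M.mean t ζ) :
    ∑ i, M.load t η i = ∑ i, M.load t ζ i := by
  have h' : (M.integral t fun _ => η) = M.integral t fun _ => ζ := by
    rcases isEmpty_or_nonempty (Fin M.numTris) with hK | ⟨⟨K⟩⟩
    · simp [integral]
    · exact (div_left_inj' (integral_one_pos (jac_pos hM ht) K).ne').1 h
  rwa [integral_shape hM ht hη, integral_shape hM ht hζ] at h'

end EvolvingMesh

/-! ### The semi-discrete system in nodal form -/

/-- Monotonicity of `f(r) = log ((1 + r) / (1 - r))` on `(-1, 1)`. -/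
lemma sub_mul_logPotDeriv_sub_nonneg {a b : ℝ} (ha : |a| < 1) (hb : |b| < 1) :
    0 ≤ (a - b) * (logPotDeriv a - logPotDeriv b) := by
  have key : ∀ {a b : ℝ}, |a| < 1 → |b| < 1 → a ≤ b → logPotDeriv a ≤ logPotDeriv b := by
    intro a b ha hb hab
    rw [abs_lt] at ha hb
    refine Real.log_le_log (div_pos (by linarith) (by linarith)) ?_
    rw [div_le_div_iff₀ (by linarith) (by linarith)]
    nlinarith
  rcases le_total a b with h | h
  · exact mul_nonneg_of_nonpos_of_nonpos (sub_nonpos.2 h) (sub_nonpos.2 (key ha hb h))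
  · exact mul_nonneg (sub_nonneg.2 h) (sub_nonneg.2 (key hb ha h))

namespace EvolvingMesh

variable {T : ℝ} {S : EvolvingSurface T} {M : EvolvingMesh S} {ρ ε θ t : ℝ} {U₀ : E3 → ℝ}
  {U W : ℝ → E3 → ℝ}

lemma continuousOn_nodal_value {z : ℝ → E3 → ℝ}
    (hz : ContinuousOn (fun q : ℝ × E3 => z q.1 q.2) M.spacetime) (i : Fin M.numNodes) :
    ContinuousOn (fun t => z t (M.node i t)) (Icc 0 T) :=
  hz.comp (continuousOn_id.prodMk (continuousOn_node i)) fun t ht => ⟨ht, node_mem_surf i t⟩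

lemma hasDerivWithinAt_nodal_value {z z' : ℝ → E3 → ℝ} (hz : M.IsMaterialDeriv z z')
    (ht : t ∈ Icc 0 T) (i : Fin M.numNodes) :
    HasDerivWithinAt (fun s => z s (M.node i s)) (z' t (M.node i t)) (Icc 0 T) t := by
  obtain ⟨K, hK⟩ := M.node_covered i
  have hs : ∀ s, ∑ j, (Pi.single i 1 : Fin M.numNodes → ℝ) j • M.node j s = M.node i s :=
    fun s => by simp [Pi.single_apply]
  have := hz K (Pi.single i 1) (fun j => by by_cases h : j = i <;> simp [h])
    (by simp) (fun j hj => Pi.single_eq_of_ne (by rintro rfl; exact hj hK) _) t ht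
  simpa only [hs] using this

lemma continuousOn_mulVec (hM : M.IsAdmissible ρ) {v : ℝ → Fin M.numNodes → ℝ}
    (hv : ∀ i, ContinuousOn (fun t => v t i) (Icc 0 T)) (i : Fin M.numNodes) :
    ContinuousOn (fun t => (M.stiffMatrix t).mulVec (v t) i) (Icc 0 T) :=
  continuousOn_finsetSum Finset.univ fun j _ => ContinuousOn.fun_mul
    (fun _ ht => (hasDerivWithinAt_stiffMatrix hM ht i j).continuousWithinAt) (hv j)

/-- The first equation holds at every time: `(m_i u_i)' + (A w)_i = 0`. It is continuous in time,
and the weighted mass in `g_h` is the derivative of the lumped mass. -/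
lemma hasDerivWithinAt_load (hM : M.IsAdmissible ρ) (hT : 0 < T)
    (h : IsSemiDiscreteSolution M ε θ U₀ U W) (ht : t ∈ Icc 0 T) (i : Fin M.numNodes) :
    HasDerivWithinAt (fun s => M.load s (U s) i)
      (-(M.stiffMatrix t).mulVec (fun j => W t (M.node j t)) i) (Icc 0 T) t := by
  obtain ⟨U', hU'c, hU', heq⟩ := h.equations
  have hd := fun t (ht : t ∈ Icc 0 T) =>
    (hasDerivWithinAt_mass hM ht i).mul (hasDerivWithinAt_nodal_value hU' ht i)
  refine (hd t ht).congr_deriv ?_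
  have hm : ContinuousOn (fun t => M.mass t i) (Icc 0 T) := fun t ht =>
    (hasDerivWithinAt_mass hM ht i).continuousWithinAt
  refine Measure.eqOn_Icc_of_ae_eq (μ := volume) hT.ne
    (f := fun t => M.massDeriv t i * U t (M.node i t) + M.mass t i * U' t (M.node i t))
    (g := fun t => -(M.stiffMatrix t).mulVec (fun j => W t (M.node j t)) i) ?_
    (((continuousOn_massDeriv hM i).mul (continuousOn_nodal_value h.U_discrete.1 i)).add
      (hm.mul (continuousOn_nodal_value hU'c i)))
    (continuousOn_mulVec hM (fun j => continuousOn_nodal_value h.W_discrete.1 j) i).neg ht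
  filter_upwards [heq, ae_restrict_mem measurableSet_Icc] with s hs hsI
  have h1 := (hs _ (nodal_mem_shape hM hsI (Pi.single i 1))).1
  rw [lumped_nodal_single hM hsI, aForm_nodal_single hM hsI, gForm_interp_one hM hsI] at h1
  simp only [nodal_node hM hsI, Pi.single_apply, mul_ite, mul_one, mul_zero, Finset.sum_ite_eq',
    Finset.mem_univ, if_true, load] at h1
  linarith

/-- The second equation in nodal form. It holds for almost every time only, because the logarithm
need not stay finite at exceptional times. -/
lemma ae_load_eq (hM : M.IsAdmissible ρ) (h : IsSemiDiscreteSolution M ε θ U₀ U W) :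
    ∀ᵐ t ∂(volume.restrict (Icc 0 T)), ∀ i, |U t (M.node i t)| < 1 ∧ M.load t (W t) i =
      ε * (M.stiffMatrix t).mulVec (fun j => U t (M.node j t)) i
        + θ / (2 * ε) * (M.mass t i * logPotDeriv (U t (M.node i t)))
        - 1 / ε * M.load t (U t) i := by
  obtain ⟨U', -, -, heq⟩ := h.equations
  filter_upwards [heq, h.abs_lt_one, ae_restrict_mem measurableSet_Icc] with s hs hs1 hsI i
  refine ⟨hs1 _ (node_mem_surf i s), ?_⟩
  have h1 := (hs _ (nodal_mem_shape hM hsI (Pi.single i 1))).2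
  rw [lumped_nodal_single hM hsI, lumped_nodal_single hM hsI, lumped_nodal_single hM hsI,
    aForm_nodal_single hM hsI] at h1
  rw [h1]
  congr 3
  exact congrArg (M.mass s i * ·) (nodal_node hM hsI (fun j => logPotDeriv (U s (M.node j s))) i)

/-! ### The difference of two solutions -/

variable {U₀₁ U₀₂ : E3 → ℝ} {U₁ W₁ U₂ W₂ : ℝ → E3 → ℝ}

lemma load_sub (t : ℝ) (η ζ : E3 → ℝ) (i : Fin M.numNodes) :
    M.load t (η - ζ) i = M.load t η i - M.load t ζ i := by
  simp only [load, Pi.sub_apply]; ring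

lemma continuousOn_sub_node (i : Fin M.numNodes) {z₁ z₂ : ℝ → E3 → ℝ}
    (h₁ : M.IsDiscreteFn z₁) (h₂ : M.IsDiscreteFn z₂) :
    ContinuousOn (fun t => (z₁ t - z₂ t) (M.node i t)) (Icc 0 T) :=
  (continuousOn_nodal_value h₁.1 i).sub (continuousOn_nodal_value h₂.1 i)

lemma hasDerivWithinAt_load_sub (hM : M.IsAdmissible ρ) (hT : 0 < T)
    (h₁ : IsSemiDiscreteSolution M ε θ U₀₁ U₁ W₁) (h₂ : IsSemiDiscreteSolution M ε θ U₀₂ U₂ W₂)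
    (ht : t ∈ Icc 0 T) (i : Fin M.numNodes) :
    HasDerivWithinAt (fun s => M.load s (U₁ s - U₂ s) i)
      ((-(M.stiffMatrix t).mulVec fun j => (W₁ t - W₂ t) (M.node j t)) i) (Icc 0 T) t := by
  have h := (hasDerivWithinAt_load hM hT h₁ ht i).sub (hasDerivWithinAt_load hM hT h₂ ht i)
  have e1 : (fun s => M.load s (U₁ s - U₂ s) i) =
      (fun s => M.load s (U₁ s) i) - fun s => M.load s (U₂ s) i :=
    funext fun s => load_sub s _ _ i
  have e2 : (fun j => (W₁ t - W₂ t) (M.node j t)) =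
      (fun j => W₁ t (M.node j t)) - fun j => W₂ t (M.node j t) := rfl
  rw [e1, e2, Matrix.mulVec_sub]
  refine h.congr_deriv ?_
  simp only [Pi.neg_apply, Pi.sub_apply]
  ring

/-- Conservation of mass: the difference of two solutions stays mean free. -/
lemma sum_load_sub_eq_zero (hM : M.IsAdmissible ρ) (hT : 0 < T)
    (h₁ : IsSemiDiscreteSolution M ε θ U₀₁ U₁ W₁) (h₂ : IsSemiDiscreteSolution M ε θ U₀₂ U₂ W₂)
    (h0 : ∑ i, M.load 0 (U₁ 0 - U₂ 0) i = 0) (ht : t ∈ Icc 0 T) :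
    ∑ i, M.load t (U₁ t - U₂ t) i = 0 := by
  have hd : ∀ s ∈ Icc 0 T, HasDerivWithinAt (fun s => ∑ i, M.load s (U₁ s - U₂ s) i) 0
      (Icc 0 T) s := by
    intro s hs
    refine (HasDerivWithinAt.fun_sum fun i _ =>
      hasDerivWithinAt_load_sub hM hT h₁ h₂ hs i).congr_deriv ?_
    rw [← one_dotProduct, dotProduct_neg,
      dotProduct_mulVec_comm_of_isSymm (isSymm_stiffMatrix s), stiffMatrix_mulVec_one,
      dotProduct_zero, neg_zero]
  have := constant_of_has_deriv_right_zero (fun s hs => (hd s hs).continuousWithinAt)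
    (fun s hs => (hd s (Ico_subset_Icc_self hs)).mono_of_mem_nhdsWithin
      (Icc_mem_nhdsGE_of_mem hs)) t ht
  rw [this, h0]

/-- The second equation, tested with the difference `u` of the solutions: monotonicity of the
logarithmic term bounds `∫ I_h(u w)` from below. -/
lemma mul_stiffForm_sub_le (hM : M.IsAdmissible ρ) (hT : 0 < T) (hε : 0 < ε) (hθ : 0 < θ)
    (h₁ : IsSemiDiscreteSolution M ε θ U₀₁ U₁ W₁) (h₂ : IsSemiDiscreteSolution M ε θ U₀₂ U₂ W₂)
    (ht : t ∈ Icc 0 T) :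
    ε * ((fun i => (U₁ t - U₂ t) (M.node i t)) ⬝ᵥ
        (M.stiffMatrix t).mulVec fun i => (U₁ t - U₂ t) (M.node i t)) ≤
      (fun i => (W₁ t - W₂ t) (M.node i t)) ⬝ᵥ M.load t (U₁ t - U₂ t)
        + 1 / ε * ((fun i => (U₁ t - U₂ t) (M.node i t)) ⬝ᵥ M.load t (U₁ t - U₂ t)) := by
  have hu := fun i => continuousOn_sub_node (M := M) i h₁.U_discrete h₂.U_discrete
  have hw := fun i => continuousOn_sub_node (M := M) i h₁.W_discrete h₂.W_discrete
  have hz : ∀ i, ContinuousOn (fun t => M.load t (U₁ t - U₂ t) i) (Icc 0 T) := fun i t ht =>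
    (hasDerivWithinAt_load_sub hM hT h₁ h₂ ht i).continuousWithinAt
  refine le_on_Icc_of_ae_le hT
    (f := fun t => ε * ((fun i => (U₁ t - U₂ t) (M.node i t)) ⬝ᵥ
        (M.stiffMatrix t).mulVec fun i => (U₁ t - U₂ t) (M.node i t)))
    (g := fun t => (fun i => (W₁ t - W₂ t) (M.node i t)) ⬝ᵥ M.load t (U₁ t - U₂ t)
        + 1 / ε * ((fun i => (U₁ t - U₂ t) (M.node i t)) ⬝ᵥ M.load t (U₁ t - U₂ t)))
    (continuousOn_const.mul (continuousOn_finsetSum Finset.univ fun i _ =>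
      (hu i).mul (continuousOn_mulVec hM hu i)))
    ((continuousOn_finsetSum Finset.univ fun i _ => (hw i).mul (hz i)).add
      (continuousOn_const.mul (continuousOn_finsetSum Finset.univ fun i _ => (hu i).mul (hz i))))
    ?_ t ht
  filter_upwards [ae_load_eq hM h₁, ae_load_eq hM h₂, ae_restrict_mem measurableSet_Icc]
    with s hs₁ hs₂ hsI
  simp only [dotProduct, Finset.mul_sum]
  rw [← Finset.sum_add_distrib]
  refine Finset.sum_le_sum fun i _ => ?_
  have e : (fun i => (U₁ s - U₂ s) (M.node i s)) =
      (fun j => U₁ s (M.node j s)) - fun j => U₂ s (M.node j s) := rfl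
  rw [e, Matrix.mulVec_sub, load_sub]
  simp only [Pi.sub_apply]
  obtain ⟨a₁, b₁⟩ := hs₁ i
  obtain ⟨a₂, b₂⟩ := hs₂ i
  have hmono := sub_mul_logPotDeriv_sub_nonneg a₁ a₂
  have hm := mass_pos hM hsI i
  have hc : 0 ≤ θ / (2 * ε) * M.mass s i := by positivity
  simp only [load] at b₁ b₂ ⊢
  generalize (M.stiffMatrix s).mulVec (fun j => U₁ s (M.node j s)) i = A₁ at *
  generalize (M.stiffMatrix s).mulVec (fun j => U₂ s (M.node j s)) i = A₂ at *
  have key : (W₁ s (M.node i s) - W₂ s (M.node i s)) *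
      (M.mass s i * U₁ s (M.node i s) - M.mass s i * U₂ s (M.node i s)) =
      (U₁ s (M.node i s) - U₂ s (M.node i s)) *
        (M.mass s i * W₁ s (M.node i s) - M.mass s i * W₂ s (M.node i s)) := by ring
  -- what is left is the nodal contribution of the logarithmic term, which has a sign
  rw [key, b₁, b₂]
  nlinarith [mul_nonneg hc hmono]

/-- The energy estimate for the difference of two solutions, in nodal form. -/
lemma energy_estimate (hM : M.IsAdmissible ρ) (hρ : 0 < ρ) (hT : 0 < T) (hε : 0 < ε) (hθ : 0 < θ)
    {L : ℝ} (hL0 : 0 ≤ L)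
    (hL : ∀ t ∈ Icc 0 T, ∀ x ∈ S.surf t, ∀ y ∈ S.surf t,
      ‖S.velocity t x - S.velocity t y‖ ≤ L * ‖x - y‖)
    (h₁ : IsSemiDiscreteSolution M ε θ U₀₁ U₁ W₁) (h₂ : IsSemiDiscreteSolution M ε θ U₀₂ U₂ W₂)
    (h0 : ∑ i, M.load 0 (U₁ 0 - U₂ 0) i = 0) :
    ContinuousOn (fun s => M.gradNormSq s (U₁ s - U₂ s)) (Icc 0 T) ∧ ∀ t ∈ Icc 0 T,
      M.invNorm t (U₁ t - U₂ t) ^ 2 + ε * ∫ s in (0 : ℝ)..t, M.gradNormSq s (U₁ s - U₂ s) ≤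
        Real.exp (((ε ^ 3)⁻¹ + (4 * L / ρ + 4 * L / ρ ^ 2)) * t) *
          M.invNorm 0 (U₁ 0 - U₂ 0) ^ 2 := by
  have h0T : (0 : ℝ) ∈ Icc 0 T := ⟨le_rfl, hT.le⟩
  have hu := fun i => continuousOn_sub_node (M := M) i h₁.U_discrete h₂.U_discrete
  have hsum := fun t (ht : t ∈ Icc 0 T) => sum_load_sub_eq_zero hM hT h₁ h₂ h0 ht
  set u : ℝ → Fin M.numNodes → ℝ := fun t i => (U₁ t - U₂ t) (M.node i t) with hu_def
  set w : ℝ → Fin M.numNodes → ℝ := fun t i => (W₁ t - W₂ t) (M.node i t) with hw_def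
  set z : ℝ → Fin M.numNodes → ℝ := fun t => M.load t (U₁ t - U₂ t) with hz_def
  set G : ℝ → Fin M.numNodes → ℝ := fun t =>
    meanFreeSolution (M.stiffMatrix t) (M.mass t) (z t) with hG_def
  have hAG : ∀ t ∈ Icc 0 T, (M.stiffMatrix t).mulVec (G t) = z t := fun t ht =>
    ((meanFreeSolution_stiffMatrix hM ht).2 _ (hsum t ht)).1
  have hD : ∀ t ∈ Icc 0 T, M.gradNormSq t (U₁ t - U₂ t) =
      u t ⬝ᵥ (M.stiffMatrix t).mulVec (u t) := fun t ht => by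
    rw [gradNormSq_eq hM ht, dotProduct_stiffMatrix]
  have hDc : ContinuousOn (fun s => M.gradNormSq s (U₁ s - U₂ s)) (Icc 0 T) :=
    ContinuousOn.congr (continuousOn_finsetSum Finset.univ fun i _ =>
      (hu i).mul (continuousOn_mulVec hM hu i)) hD
  refine ⟨hDc, fun t ht => ?_⟩
  rw [(invNorm_sq hM ht (hsum t ht)).2, (invNorm_sq hM h0T h0).2]
  refine gronwall_with_dissipation (E := fun t => G t ⬝ᵥ z t)
    (E' := fun t => 2 * (G t ⬝ᵥ -(M.stiffMatrix t).mulVec (w t)) - G t ⬝ᵥ (Matrix.of fun i j =>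
      M.stiffFormDeriv t (Pi.single i 1) (Pi.single j 1)).mulVec (G t))
    hε.le (by positivity) hDc (fun s hs => by rw [hD s hs]; exact stiffMatrix_nonneg s _)
    (fun s hs => ?_) (fun s hs => ?_) ht
  · refine hasDerivWithinAt_energy (uniqueDiffOn_Icc hT s hs) hs (isSymm_stiffMatrix s)
      (fun i j => hasDerivWithinAt_stiffMatrix hM hs i j)
      (fun i => hasDerivWithinAt_load_sub hM hT h₁ h₂ hs i) (fun i => ?_) hAG
    exact differentiableWithinAt_meanFreeSolution
      (fun i j => (hasDerivWithinAt_stiffMatrix hM hs i j).differentiableWithinAt)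
      (fun i => (hasDerivWithinAt_mass hM hs i).differentiableWithinAt)
      (fun i => (hasDerivWithinAt_load_sub hM hT h₁ h₂ hs i).differentiableWithinAt)
      (meanFreeSolution_stiffMatrix hM hs).1 i
  · have hsymm := isSymm_stiffMatrix (M := M) s
    have e1 : G s ⬝ᵥ -(M.stiffMatrix s).mulVec (w s) = -(w s ⬝ᵥ z s) := by
      rw [dotProduct_neg, dotProduct_mulVec_comm_of_isSymm hsymm, hAG s hs]
    have e2 : G s ⬝ᵥ z s = M.stiffForm s (G s) (G s) := by
      rw [← dotProduct_stiffMatrix, hAG s hs]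
    have e3 : G s ⬝ᵥ (Matrix.of fun i j =>
        M.stiffFormDeriv s (Pi.single i 1) (Pi.single j 1)).mulVec (G s) =
        M.stiffFormDeriv s (G s) (G s) := by
      -- both sides are the derivative of `r ↦ a_h(r; G s, G s)` at `r = s`
      have d1 : HasDerivWithinAt (fun r => M.stiffForm r (G s) (G s)) (G s ⬝ᵥ (Matrix.of fun i j =>
          M.stiffFormDeriv s (Pi.single i 1) (Pi.single j 1)).mulVec (G s)) (Icc 0 T) s := by
        simp only [← dotProduct_stiffMatrix]
        exact HasDerivWithinAt.fun_sum fun i _ => HasDerivWithinAt.const_mul _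
          (HasDerivWithinAt.fun_sum (u := Finset.univ) fun j _ =>
            (hasDerivWithinAt_stiffMatrix hM hs i j).mul_const (G s j))
      exact (uniqueDiffOn_Icc hT s hs).eq_deriv _ d1 (hasDerivWithinAt_stiffForm hM hs _ _)
    have b1 := (abs_le.1 (abs_stiffFormDeriv_le hM hρ hs hL0 (hL s hs) (G s))).1
    have b2 : ε * (u s ⬝ᵥ (M.stiffMatrix s).mulVec (u s)) ≤ w s ⬝ᵥ z s + 1 / ε * (u s ⬝ᵥ z s) :=
      mul_stiffForm_sub_le hM hT hε hθ h₁ h₂ hs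
    -- the weight `ε²` in Young's inequality lets the Dirichlet form absorb half of the product
    have b3 := two_mul_dotProduct_mulVec_le hsymm (stiffMatrix_nonneg s) (u s) (G s)
      (pow_pos hε 2)
    rw [hAG s hs, e2] at b3
    have b4 : 2 * (1 / ε * (u s ⬝ᵥ z s)) ≤ ε * (u s ⬝ᵥ (M.stiffMatrix s).mulVec (u s)) +
        (ε ^ 3)⁻¹ * M.stiffForm s (G s) (G s) := by
      have := mul_le_mul_of_nonneg_left b3 (one_div_pos.2 hε).le
      refine (le_of_eq ?_).trans (this.trans_eq ?_)
      · ring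
      · field_simp
    change 2 * (G s ⬝ᵥ -(M.stiffMatrix s).mulVec (w s)) - _ + ε * M.gradNormSq s (U₁ s - U₂ s) ≤
      _ * (G s ⬝ᵥ z s)
    rw [e1, e2, e3, hD s hs]
    linarith

/-- If the norm of the difference vanishes, then the two solutions have the same values of `U_h`. -/
lemma eq_of_invNorm_eq_zero (hM : M.IsAdmissible ρ) (ht : t ∈ Icc 0 T)
    (h0 : ∑ i, M.load t (U₁ t - U₂ t) i = 0) (h : M.invNorm t (U₁ t - U₂ t) ^ 2 = 0)
    (i : Fin M.numNodes) : U₁ t (M.node i t) = U₂ t (M.node i t) := by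
  rw [(invNorm_sq hM ht h0).2] at h
  obtain ⟨hAG, -⟩ := (meanFreeSolution_stiffMatrix hM ht).2 _ h0
  set G := meanFreeSolution (M.stiffMatrix t) (M.mass t) (M.load t (U₁ t - U₂ t))
  have hconst := const_of_stiffForm_self_eq_zero hM ht (η := G) (by
    rw [← dotProduct_stiffMatrix, hAG, h])
  have hG : G = G i • 1 := funext fun j => by simp [hconst j i]
  rw [hG, Matrix.mulVec_smul, stiffMatrix_mulVec_one, smul_zero] at hAG
  have h1 := congrFun hAG i
  simp only [Pi.zero_apply, load, Pi.sub_apply] at h1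
  exact sub_eq_zero.1 ((mul_eq_zero.1 h1.symm).resolve_left (mass_pos hM ht i).ne')

/-- If the values of `U_h` agree, then the second equation determines `W_h` for almost every time,
and continuity does so for the remaining times. -/
lemma W_eq_of_U_eq (hM : M.IsAdmissible ρ) (hT : 0 < T)
    (h₁ : IsSemiDiscreteSolution M ε θ U₀₁ U₁ W₁) (h₂ : IsSemiDiscreteSolution M ε θ U₀₂ U₂ W₂)
    (hU : ∀ t ∈ Icc 0 T, ∀ i, U₁ t (M.node i t) = U₂ t (M.node i t)) (ht : t ∈ Icc 0 T)
    (i : Fin M.numNodes) : W₁ t (M.node i t) = W₂ t (M.node i t) := by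
  refine Measure.eqOn_Icc_of_ae_eq (μ := volume) hT.ne (f := fun t => W₁ t (M.node i t))
    (g := fun t => W₂ t (M.node i t)) ?_ (continuousOn_nodal_value h₁.W_discrete.1 i)
    (continuousOn_nodal_value h₂.W_discrete.1 i) ht
  filter_upwards [ae_load_eq hM h₁, ae_load_eq hM h₂, ae_restrict_mem measurableSet_Icc]
    with s hs₁ hs₂ hsI
  have e := (hs₁ i).2
  have e' := (hs₂ i).2
  simp only [load, funext fun j => hU s hsI j, hU s hsI i] at e e'
  exact mul_left_cancel₀ (mass_pos hM hsI i).ne' (e.trans e'.symm)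

lemma eqOn_surf (hM : M.IsAdmissible ρ) (ht : t ∈ Icc 0 T) {η ζ : E3 → ℝ} (hη : η ∈ M.shape t)
    (hζ : ζ ∈ M.shape t) (h : ∀ i, η (M.node i t) = ζ (M.node i t)) :
    EqOn η ζ (M.surf t) := by
  intro x hx
  rw [eqOn_nodal hM ht hη hx, eqOn_nodal hM ht hζ hx, funext h]

end EvolvingMesh

end ESFEM

theorem mainTheorem6 (T : ℝ) (hT : 0 < T) (S : ESFEM.EvolvingSurface T)
    (ε θ ρ : ℝ) (hε : 0 < ε) (hθ₀ : 0 < θ) (hθ₁ : θ < 1) (hρ : 0 < ρ) :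
    ∃ C : ℝ, ∀ M : ESFEM.EvolvingMesh S, M.IsAdmissible ρ →
      ∀ U₀₁ ∈ M.admissibleData, ∀ U₀₂ ∈ M.admissibleData, M.mean 0 U₀₁ = M.mean 0 U₀₂ →
      ∀ U₁ W₁ U₂ W₂ : ℝ → ESFEM.E3 → ℝ,
        ESFEM.IsSemiDiscreteSolution M ε θ U₀₁ U₁ W₁ →
        ESFEM.IsSemiDiscreteSolution M ε θ U₀₂ U₂ W₂ →
        (∀ t ∈ Set.Icc 0 T,
          M.IsLumpedInvLap t (U₁ t - U₂ t) (M.lumpedInvLap t (U₁ t - U₂ t)) ∧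
          IntervalIntegrable (fun s => M.gradNormSq s (U₁ s - U₂ s)) MeasureTheory.volume 0 t ∧
          M.invNorm t (U₁ t - U₂ t) ^ 2
              + ε * ∫ s in (0 : ℝ)..t, M.gradNormSq s (U₁ s - U₂ s)
            ≤ Real.exp (C * t) * M.invNorm 0 (U₀₁ - U₀₂) ^ 2) ∧
        (Set.EqOn U₀₁ U₀₂ (M.surf 0) → ∀ t ∈ Set.Icc 0 T,
          Set.EqOn (U₁ t) (U₂ t) (M.surf t) ∧ Set.EqOn (W₁ t) (W₂ t) (M.surf t)) := by
  obtain ⟨L, hL0, hL⟩ := S.exists_lipschitz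
  refine ⟨(ε ^ 3)⁻¹ + (4 * L / ρ + 4 * L / ρ ^ 2), ?_⟩
  intro M hM U₀₁ hU₀₁ U₀₂ hU₀₂ hmean U₁ W₁ U₂ W₂ h₁ h₂
  have h0T : (0 : ℝ) ∈ Set.Icc 0 T := ⟨le_rfl, hT.le⟩
  have hload : M.load 0 (U₁ 0 - U₂ 0) = M.load 0 (U₀₁ - U₀₂) := by
    funext i
    simp only [ESFEM.EvolvingMesh.load, Pi.sub_apply,
      h₁.initial (ESFEM.EvolvingMesh.node_mem_surf i 0),
      h₂.initial (ESFEM.EvolvingMesh.node_mem_surf i 0)]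
  have h0' : ∑ i, M.load 0 (U₀₁ - U₀₂) i = 0 := by
    simp only [ESFEM.EvolvingMesh.load_sub, Finset.sum_sub_distrib]
    exact sub_eq_zero.2
      (ESFEM.EvolvingMesh.sum_load_eq_of_mean_eq hM h0T hU₀₁.1 hU₀₂.1 hmean)
  have h0 : ∑ i, M.load 0 (U₁ 0 - U₂ 0) i = 0 := by rw [hload, h0']
  have hinit : M.invNorm 0 (U₁ 0 - U₂ 0) ^ 2 = M.invNorm 0 (U₀₁ - U₀₂) ^ 2 := by
    rw [(ESFEM.EvolvingMesh.invNorm_sq hM h0T h0).2, (ESFEM.EvolvingMesh.invNorm_sq hM h0T h0').2,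
      hload]
  have hsum := fun t (ht : t ∈ Set.Icc 0 T) =>
    ESFEM.EvolvingMesh.sum_load_sub_eq_zero hM hT h₁ h₂ h0 ht
  obtain ⟨hDc, hmain⟩ :=
    ESFEM.EvolvingMesh.energy_estimate hM hρ hT hε hθ₀ hL0 hL h₁ h₂ h0
  rw [hinit] at hmain
  refine ⟨fun t ht => ⟨(ESFEM.EvolvingMesh.invNorm_sq hM ht (hsum t ht)).1, ?_, hmain t ht⟩, ?_⟩
  · refine (hDc.mono ?_).intervalIntegrable
    rw [Set.uIcc_of_le ht.1]
    exact Set.Icc_subset_Icc_right ht.2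
  intro heq
  have hzero : M.invNorm 0 (U₀₁ - U₀₂) ^ 2 = 0 := by
    have hl : M.load 0 (U₀₁ - U₀₂) = 0 := by
      funext i
      simp [ESFEM.EvolvingMesh.load, heq (ESFEM.EvolvingMesh.node_mem_surf i 0)]
    rw [(ESFEM.EvolvingMesh.invNorm_sq hM h0T h0').2, hl, dotProduct_zero]
  have hU : ∀ t ∈ Set.Icc 0 T, ∀ i, U₁ t (M.node i t) = U₂ t (M.node i t) := by
    intro t ht i
    refine ESFEM.EvolvingMesh.eq_of_invNorm_eq_zero hM ht (hsum t ht) ?_ i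
    have h := hmain t ht
    rw [hzero, mul_zero] at h
    have hint : 0 ≤ ∫ s in (0 : ℝ)..t, M.gradNormSq s (U₁ s - U₂ s) :=
      intervalIntegral.integral_nonneg ht.1 fun s hs => by
        rw [ESFEM.EvolvingMesh.gradNormSq_eq hM ⟨hs.1, hs.2.trans ht.2⟩]
        exact ESFEM.EvolvingMesh.stiffForm_self_nonneg s _
    exact le_antisymm (by linarith [mul_nonneg hε.le hint]) (sq_nonneg _)
  intro t ht
  exact ⟨ESFEM.EvolvingMesh.eqOn_surf hM ht (h₁.U_discrete.2 t ht)
      (h₂.U_discrete.2 t ht) (hU t ht),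
    ESFEM.EvolvingMesh.eqOn_surf hM ht (h₁.W_discrete.2 t ht) (h₂.W_discrete.2 t ht)
      (ESFEM.EvolvingMesh.W_eq_of_U_eq hM hT h₁ h₂ hU ht)⟩
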